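/- Let $0<q<1$. For $x\in\mathbb{C}$ write $x=\cos\theta=(z+1/z)/2$ with $z=e^{i\theta}$, and let $(a;p)_n=\prod_{k=0}^{n-1}(1-ap^k)$, $(a;p)_\infty=\prod_{k\ge 0}(1-ap^k)$, $(a,b;p)_n=(a;p)_n(b;p)_n$. Let $\mathcal{D}_q$ be the Askey–Wilson operator $$\mathcal{D}_qf(x)=\frac{\breve f(q^{1/2}z)-\breve f(q^{-1/2}z)}{(q^{1/2}-q^{-1/2})(z-1/z)/2},\qquad \breve f(z):=f\big((z+1/z)/2\big)$$ (defined by its limit at $x=\pm1$), and put $$\eta=\frac{q^{1/4}+q^{-1/4}}{2},\qquad \gamma=\frac{2q^{1/4}}{1-q}.$$ Let $\rho_0=1$ and $\rho_n(x)=(1+e^{2i\theta})(-q^{2-n}e^{2i\theta};q^2)_{n-1}e^{-in\theta}$ for $n\ge1$. For $|w|<1$ let $$\mathcal{E}_q(x;w)=\frac{(w^2;q^2)_\infty}{(qw^2;q^2)_\infty}\sum_{n=0}^\infty\frac{(-iw)^n}{(q;q)_n}q^{n^2/4}\big(-ie^{i\theta}q^{(1-n)/2},-ie^{-i\theta}q^{(1-n)/2};q\big)_n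 ,$$ and define the $q$-Bernoulli polynomials $\mathcal{B}_n(x;q)$ and $\beta_n(x;q)$ by the generating functions (for small $w\neq0$) $$\sum_{n=0}^\infty\mathcal{B}_n(x;q)w^n=\frac{w\,\mathcal{E}_q(x;w)}{\mathcal{E}_q(\eta;w)-\mathcal{E}_q(\eta;-w)},\qquad \sum_{n=0}^\infty\beta_n(x;q)w^n=\frac{w\,\mathcal{E}_q(\eta;-w)\,\mathcal{E}_q(x;w)}{\mathcal{E}_q(\eta;w)-\mathcal{E}_q(\eta;-w)} .$$ Let $w_1$ be the smallest positive zero of $$S_q(\eta;w)=\frac{(-iw;q^{1/2})_\infty-(iw;q^{1/2})_\infty}{2i(-qw^2;q^2)_\infty}.$$ Say that an entire function $f$ has $q$-exponential growth of order $k$ and type $\alpha$ (with $k,\alpha$ real) if there is $K>0$ with $$|f(x)|<K|x|^\alpha\exp\Big(\frac{k\ln^2|x|}{2\ln^2q}\Big)\qquad(x\in\mathbb{C}\setminus\{0\}).$$ **Theorem.** Let $f$ be an entire function of $q$-exponential growth of some order $k<2\ln q^{-1}$ (and some type), or of order $2\ln q^{-1}$ and some type $\alpha<\frac{2\ln2}{\ln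 q^{-1}}$. Then, for all $x\in\mathbb{C}$, with an unconditionally convergent series, $$f(x)=\sum_{k=0}^\infty f_k\,\rho_k(x),\qquad f_k=\frac{q^{(k^2-k)/4}(1-q)^k}{2^k(q;q)_k}\,\mathcal{D}_q^kf(0).$$ If moreover $$\limsup_{n\to\infty}\big|\gamma^{-n}\mathcal{D}_q^nf(0)\big|^{1/n}=\tau,\qquad 0<\tau<\min(1,w_1),$$ then for all $x\in\mathbb{C}$ $$f(x)=2\sum_{k=0}^\infty\gamma^{-2k}\,\mathcal{D}_q^{2k}f(\eta)\,\mathcal{B}_{2k+1}(x;q)-2\sum_{k=0}^\infty\gamma^{-2k}\,\mathcal{D}_q^{2k}f(0)\,\beta_{2k+1}(x;q),$$ where both series converge unconditionally. -/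

import Mathlib

open Filter Topology

noncomputable section

namespace AWLidstone

/-- The finite `q`-shifted factorial `(a; p)_n`. -/
def qPoch (a p : ℂ) (n : ℕ) : ℂ := ∏ k ∈ Finset.range n, (1 - a * p ^ k)

/-- The infinite `q`-shifted factorial `(a; p)_∞`. -/
def qPochInf (a p : ℂ) : ℂ := ∏' k : ℕ, (1 - a * p ^ k)

/-- The real power `q ^ s` of the positive real number `q`, as a complex number. -/
def rp (q s : ℝ) : ℂ := ((q ^ s : ℝ) : ℂ)

/-- The map `z ↦ (z + 1/z) / 2`. -/
def jouk (z : ℂ) : ℂ := (z + z⁻¹) / 2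

/-- A number `z = e^{iθ}` with `x = cos θ = (z + 1/z) / 2`, for complex `x`. The other choice is
`1/z`; everything below is symmetric under `z ↔ 1/z`. -/
def eith (x : ℂ) : ℂ := x + (x ^ 2 - 1) ^ (1 / 2 : ℂ)

theorem eith_ne_zero (x : ℂ) : eith x ≠ 0 := by
  intro h
  have h1 : ((x ^ 2 - 1) ^ (1 / 2 : ℂ)) ^ 2 = x ^ 2 - 1 := by
    simp
  have h2 : (x ^ 2 - 1) ^ (1 / 2 : ℂ) = -x := by
    unfold eith at h
    linear_combination h
  rw [h2] at h1
  have h3 : (1 : ℂ) = 0 := by linear_combination h1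
  exact one_ne_zero h3

/-- `eith x` is indeed a preimage of `x` under `z ↦ (z + 1/z) / 2`. -/
theorem jouk_eith (x : ℂ) : jouk (eith x) = x := by
  have h1 : ((x ^ 2 - 1) ^ (1 / 2 : ℂ)) ^ 2 = x ^ 2 - 1 := by
    simp
  have h0 := eith_ne_zero x
  unfold jouk
  field_simp
  unfold eith
  linear_combination h1

/-- The Askey-Wilson difference quotient at `x = (z + 1/z) / 2`, `x ≠ ±1`:
`(f((q^{1/2} z + q^{-1/2}/z)/2) - f((q^{-1/2} z + q^{1/2}/z)/2))
  / ((q^{1/2} - q^{-1/2}) (z - 1/z)/2)`; note `i sin θ = (z - 1/z)/2`. -/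
def awQuot (q : ℝ) (f : ℂ → ℂ) (x : ℂ) : ℂ :=
  (f (jouk (rp q (1 / 2) * eith x)) - f (jouk (rp q (-1 / 2) * eith x))) /
    ((rp q (1 / 2) - rp q (-1 / 2)) * ((eith x - (eith x)⁻¹) / 2))

open Classical in
/-- The Askey-Wilson operator `𝒟_q`; at the two removable points `x = ±1` it is the limit of the
difference quotient. -/
def awD (q : ℝ) (f : ℂ → ℂ) (x : ℂ) : ℂ :=
  if x = 1 ∨ x = -1 then limUnder (𝓝[≠] x) (awQuot q f) else awQuot q f x

/-- `η = (q^{1/4} + q^{-1/4}) / 2`. -/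
def eta (q : ℝ) : ℂ := (rp q (1 / 4) + rp q (-1 / 4)) / 2

/-- `γ = 2 q^{1/4} / (1 - q)`, the constant in `𝒟_q ℰ_q(x; w) = γ w ℰ_q(x; w)`. -/
def gam (q : ℝ) : ℂ := 2 * rp q (1 / 4) / (1 - (q : ℂ))

/-- The polynomials `ρ_n`: `ρ_0 = 1` and
`ρ_n(x) = (1 + e^{2iθ}) (-q^{2-n} e^{2iθ}; q²)_{n-1} e^{-inθ}` for `n ≥ 1`. -/
def rho (q : ℝ) (n : ℕ) (x : ℂ) : ℂ :=
  if n = 0 then 1 else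
    (1 + eith x ^ 2) * qPoch (-rp q (2 - n) * eith x ^ 2) ((q : ℂ) ^ 2) (n - 1) *
      ((eith x)⁻¹) ^ n

/-- The `q`-exponential function `ℰ_q(x; α)`, for `|α| < 1`:
`(α²; q²)_∞ / (qα²; q²)_∞ · ∑ (-iα)^n / (q; q)_n · q^{n²/4} ·
  (-i e^{iθ} q^{(1-n)/2}, -i e^{-iθ} q^{(1-n)/2}; q)_n`. -/
def qExp (q : ℝ) (x α : ℂ) : ℂ :=
  qPochInf (α ^ 2) ((q : ℂ) ^ 2) / qPochInf ((q : ℂ) * α ^ 2) ((q : ℂ) ^ 2) *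
    ∑' n : ℕ, (-Complex.I * α) ^ n / qPoch q q n * rp q ((n : ℝ) ^ 2 / 4) *
      (qPoch (-Complex.I * eith x * rp q ((1 - n) / 2)) q n *
        qPoch (-Complex.I * (eith x)⁻¹ * rp q ((1 - n) / 2)) q n)

/-- The basic sine function at `η`, for all real `w`:
`S_q(η; w) = ((-iw; q^{1/2})_∞ - (iw; q^{1/2})_∞) / (2i (-qw²; q²)_∞)`.
For `|w| < 1` it is `(ℰ_q(η; iw) - ℰ_q(η; -iw)) / (2i)`, and this closed form is the analytic
continuation to the real line. -/
def sinEta (q : ℝ) (w : ℝ) : ℂ :=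
  (qPochInf (-Complex.I * w) (rp q (1 / 2)) - qPochInf (Complex.I * w) (rp q (1 / 2))) /
    (2 * Complex.I * qPochInf (-(q : ℂ) * (w : ℂ) ^ 2) ((q : ℂ) ^ 2))

/-- The coefficients of the power series generated by `G` near `0`: the sequence `b` with
`∑ b_n w^n = G(w)` for all small `w ≠ 0`. It is unique when it exists (`genCoeff_eq`). -/
def genCoeff (G : ℂ → ℂ) : ℕ → ℂ :=
  Classical.epsilon fun b : ℕ → ℂ => ∀ᶠ w in 𝓝[≠] (0 : ℂ), HasSum (fun n => b n * w ^ n) (G w)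

theorem genCoeff_eq {G : ℂ → ℂ} {b : ℕ → ℂ}
    (hb : ∀ᶠ w in 𝓝[≠] (0 : ℂ), HasSum (fun n => b n * w ^ n) (G w)) : genCoeff G = b := by
  have key : ∀ c : ℕ → ℂ, (∀ᶠ w in 𝓝[≠] (0 : ℂ), HasSum (fun n => c n * w ^ n) (G w)) →
      HasFPowerSeriesAt (Function.update G 0 (c 0)) (FormalMultilinearSeries.ofScalars ℂ c) 0 := by
    intro c hc
    rw [hasFPowerSeriesAt_iff]
    rw [eventually_nhdsWithin_iff] at hc
    filter_upwards [hc] with w hw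
    by_cases h : w = 0
    · subst h
      have := hasSum_single (f := fun n => (0 : ℂ) ^ n • c n) 0
        (by intro n hn; simp [hn])
      simpa [FormalMultilinearSeries.coeff_ofScalars] using this
    · have := hw h
      simpa [FormalMultilinearSeries.coeff_ofScalars, h, mul_comm] using this
  have hc : ∀ᶠ w in 𝓝[≠] (0 : ℂ), HasSum (fun n => genCoeff G n * w ^ n) (G w) :=
    Classical.epsilon_spec
      (p := fun b : ℕ → ℂ => ∀ᶠ w in 𝓝[≠] (0 : ℂ), HasSum (fun n => b n * w ^ n) (G w)) ⟨b, hb⟩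
  have h1 := key b hb
  have h2 := key _ hc
  have e : Function.update G 0 (b 0) =ᶠ[𝓝 0] Function.update G 0 (genCoeff G 0) := by
    rw [← ContinuousAt.eventuallyEq_nhds_iff_eventuallyEq_nhdsNE h1.continuousAt h2.continuousAt]
    filter_upwards [self_mem_nhdsWithin] with w hw
    have hw' : w ≠ 0 := hw
    simp [hw']
  have h3 := (h1.congr e).eq_formalMultilinearSeries h2
  funext n
  have := congrArg (fun p => FormalMultilinearSeries.coeff p n) h3
  simpa [FormalMultilinearSeries.coeff_ofScalars] using this.symm

/-- Suslov's `q`-Bernoulli polynomials: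
`∑ 𝓑_n(x; q) w^n = w ℰ_q(x; w) / (ℰ_q(η; w) - ℰ_q(η; -w))`. -/
def bernB (q : ℝ) (n : ℕ) (x : ℂ) : ℂ :=
  genCoeff (fun w => w * qExp q x w / (qExp q (eta q) w - qExp q (eta q) (-w))) n

/-- The second family of `q`-Bernoulli polynomials:
`∑ β_n(x; q) w^n = w ℰ_q(η; -w) ℰ_q(x; w) / (ℰ_q(η; w) - ℰ_q(η; -w))`. -/
def bernBeta (q : ℝ) (n : ℕ) (x : ℂ) : ℂ :=
  genCoeff (fun w => w * qExp q (eta q) (-w) * qExp q x w /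
    (qExp q (eta q) w - qExp q (eta q) (-w))) n

/-- `f` satisfies the bound of `q`-exponential growth of order `k` and type `α`:
`|f(x)| < K |x|^α exp(k ln²|x| / (2 ln² q))` for some `K > 0`. -/
def QExpGrowth (q : ℝ) (f : ℂ → ℂ) (k α : ℝ) : Prop :=
  ∃ K : ℝ, 0 < K ∧ ∀ x : ℂ, x ≠ 0 →
    ‖f x‖ < K * ‖x‖ ^ α * Real.exp (k * Real.log ‖x‖ ^ 2 / (2 * Real.log q ^ 2))

end AWLidstone

end

/-!
# The `q`-Taylor and `q`-Lidstone expansions of entire functions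

**The Taylor part.** In the variable `x` the polynomials satisfy `ρ₀ = 1`, `ρ₁ = 2x` and
`ρ_{n+2} = (4x² - 2 + qⁿ + q⁻ⁿ) ρ_n` (`rho_add_two`), so that, separately for even and odd
functions of `x`, they are Newton interpolation polynomials with nodes
`x_j = (z + 1/z) / 2`, `z = i q^{j/2}`. The Cauchy kernel expands accordingly,
`1 / (s - x) = ∑_{k<N} 4s ρ_k(x) / ρ_{k+2}(s) + remainder` (`cauchyKernel_expansion`), and
integration over a circle gives an interpolation formula for `f` with explicit contour integrals as
coefficients and remainder (`interpolation_formula`). The operator `𝒟_q` acts on the nodes as a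
central difference (`awD_iterate_latZ`), maps `ρ_n` to a multiple of `ρ_{n-1}`
(`latD_eCoef_succ`) and its `k`-th power at `0` kills the remainder (`latD_pow_rho_mul_even`); this
identifies the coefficients (`contourCoef_mul_rho`). On the circle of radius `q^{-L/2} / 2`
the polynomial `ρ_n`, `n ≤ L`, is at least a constant times `q^{-nL/2}`
(`exists_mul_pow_le_norm_rho`), while `ρ_n(x) = O(q^{-n²/4})`, and the growth hypothesis gives
`f = O(r^L q^{-L²/4})` with some `r < 1` (`exists_norm_le_on_circles`). With `L = n + O(1)` the
powers of `q` cancel, and the terms and remainders decay geometrically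
(`hasSum_awCoef_mul_eCoef`).

**The Lidstone part.** With `e_n = q^{n²/4} ρ_n / (q; q)_n` and `g_n = γ^{-n} 𝒟_qⁿ f(0)` the first
part reads `f = ∑ g_n e_n`. The same `e_n` are the coefficients of `w ↦ ℰ_q(x; w)`
(`hasSum_qExp`): the generating functions of `e_n` and of the defining series of `ℰ_q` satisfy
`q`-difference equations which the prefactor turns into each other, and the prefactor is expanded
by the `q`-binomial theorem (`hasSum_qBinomial`). Since
`γ^{-k} 𝒟_q^k f(η) = ∑_m g_{m+k} e_m(η)`, the theorem follows by summing over `n` the identity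
`e_n(x) = 2 ∑_{2k ≤ n} 𝓑_{2k+1}(x) e_{n-2k}(η) - 2 [n even] β_{n+1}(x)`, an identity of power series
in `w` (`exists_bernoulli_expansion`). The double series converges absolutely because `g_n` is
dominated by a geometric series of ratio less than the radius of convergence in `w` of the
generating functions. That radius is at least `min 1 w₁`: at `x = η` the function `ℰ_q` is an
infinite product (`qExp_eta`), and comparing the factors of `(iv; p)_∞` and `(-iv; p)_∞` shows that
the basic sine function has only real zeros (`qExp_eta_sub_ne_zero`).
-/

open Filter Topology

noncomputable section

namespace AWLidstone

/-! ### Real powers of `q` and the map `z ↦ (z + 1/z) / 2` -/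

theorem rp_add {q : ℝ} (hq : 0 < q) (s t : ℝ) : rp q (s + t) = rp q s * rp q t := by
  unfold rp; rw [Real.rpow_add hq]; push_cast; rfl

theorem rp_zero (q : ℝ) : rp q 0 = 1 := by simp [rp]

theorem rp_one (q : ℝ) : rp q 1 = q := by simp [rp]

theorem rp_ne_zero {q : ℝ} (hq : 0 < q) (s : ℝ) : rp q s ≠ 0 := by
  unfold rp; exact_mod_cast (Real.rpow_pos_of_pos hq s).ne'

theorem rp_neg {q : ℝ} (hq : 0 < q) (s : ℝ) : rp q (-s) = (rp q s)⁻¹ := by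
  unfold rp; rw [Real.rpow_neg hq.le]; push_cast; rfl

theorem rp_natCast (q : ℝ) (n : ℕ) : rp q n = (q : ℂ) ^ n := by
  unfold rp; rw [Real.rpow_natCast]; push_cast; rfl

theorem rp_half_sq {q : ℝ} (hq : 0 < q) : rp q (1 / 2) ^ 2 = q := by
  rw [sq, ← rp_add hq]; norm_num [rp_one]

theorem norm_rp {q : ℝ} (hq : 0 < q) (s : ℝ) : ‖rp q s‖ = q ^ s := by
  unfold rp; rw [Complex.norm_real, Real.norm_of_nonneg (Real.rpow_pos_of_pos hq s).le]

theorem four_jouk_sq {z : ℂ} (hz : z ≠ 0) : 4 * jouk z ^ 2 = z ^ 2 + 2 + (z⁻¹) ^ 2 := by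
  unfold jouk; field_simp; ring

theorem jouk_inv (z : ℂ) : jouk z⁻¹ = jouk z := by
  unfold jouk; rw [inv_inv, add_comm]

theorem eith_jouk {z : ℂ} (hz : z ≠ 0) : eith (jouk z) = z ∨ eith (jouk z) = z⁻¹ := by
  have h := jouk_eith (jouk z)
  have h0 := eith_ne_zero (jouk z)
  set w := eith (jouk z)
  have h2 : (w - z) * (w - z⁻¹) = 0 := by
    unfold jouk at h
    field_simp at h ⊢
    linear_combination h
  rcases mul_eq_zero.1 h2 with h3 | h3
  · exact Or.inl (sub_eq_zero.1 h3)
  · exact Or.inr (sub_eq_zero.1 h3)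

/-! ### The Askey-Wilson operator on a lattice -/

/-- The quotient defining `𝒟_q f` may be formed with either of the two preimages `z`, `1/z`;
the removable points `x = ±1` are excluded. -/
theorem awD_jouk {q : ℝ} (hq : 0 < q) (f : ℂ → ℂ) {z : ℂ} (hz : z ≠ 0) (hz1 : z ^ 2 ≠ 1) :
    awD q f (jouk z) = (f (jouk (z * rp q (1 / 2))) - f (jouk (z * (rp q (1 / 2))⁻¹))) /
      ((rp q (1 / 2) - (rp q (1 / 2))⁻¹) * ((z - z⁻¹) / 2)) := by
  have hne : ¬ (jouk z = 1 ∨ jouk z = -1) := by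
    rintro (h | h)
    · apply hz1
      unfold jouk at h; field_simp at h
      have : (z - 1) ^ 2 = 0 := by linear_combination h
      have : z = 1 := by simpa [sub_eq_zero] using this
      rw [this]; norm_num
    · apply hz1
      unfold jouk at h; field_simp at h
      have : (z + 1) ^ 2 = 0 := by linear_combination h
      have : z = -1 := by simpa [add_eq_zero_iff_eq_neg] using this
      rw [this]; norm_num
  have hm : rp q (-1 / 2) = (rp q (1 / 2))⁻¹ := by rw [← rp_neg hq]; norm_num
  rw [awD, if_neg hne, awQuot, hm]
  rcases eith_jouk hz with h | h
  · rw [h, mul_comm z, mul_comm z]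
  · have e1 : jouk (rp q (1 / 2) * z⁻¹) = jouk (z * (rp q (1 / 2))⁻¹) := by
      rw [← jouk_inv]; congr 1; simp [mul_comm]
    have e2 : jouk ((rp q (1 / 2))⁻¹ * z⁻¹) = jouk (z * rp q (1 / 2)) := by
      rw [← jouk_inv]; congr 1; simp [mul_comm]
    rw [h, e1, e2, inv_inv, ← neg_div_neg_eq]; congr 1 <;> ring

/-- The divided central difference of a function on `ℤ`, with step sizes `d`. On the lattice
`(z + 1/z) / 2`, `z = z₀ q^{j/2}`, the Askey-Wilson operator has this form. -/
def latD (d : ℤ → ℂ) : (ℤ → ℂ) →ₗ[ℂ] (ℤ → ℂ) where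
  toFun u j := (u (j + 1) - u (j - 1)) / d j
  map_add' u v := by ext j; simp only [Pi.add_apply]; ring
  map_smul' c u := by ext j; simp only [Pi.smul_apply, smul_eq_mul, RingHom.id_apply]; ring

theorem latD_apply (d u : ℤ → ℂ) (j : ℤ) : latD d u j = (u (j + 1) - u (j - 1)) / d j := rfl

/-- The lattice `z₀ q^{j/2}`, `j ∈ ℤ`. -/
def latZ (q : ℝ) (z₀ : ℂ) (j : ℤ) : ℂ := z₀ * rp q (1 / 2) ^ j

/-- The step sizes of the Askey-Wilson operator on the lattice `latZ q z₀`. -/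
def latStep (q : ℝ) (z₀ : ℂ) (j : ℤ) : ℂ :=
  (rp q (1 / 2) - (rp q (1 / 2))⁻¹) * ((latZ q z₀ j - (latZ q z₀ j)⁻¹) / 2)

theorem latZ_ne_zero {q : ℝ} (hq : 0 < q) {z₀ : ℂ} (h0 : z₀ ≠ 0) (j : ℤ) : latZ q z₀ j ≠ 0 :=
  mul_ne_zero h0 (zpow_ne_zero _ (rp_ne_zero hq _))

theorem latZ_add_one {q : ℝ} (hq : 0 < q) (z₀ : ℂ) (j : ℤ) :
    latZ q z₀ (j + 1) = latZ q z₀ j * rp q (1 / 2) := by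
  unfold latZ; rw [zpow_add_one₀ (rp_ne_zero hq _)]; ring

theorem latZ_sub_one {q : ℝ} (hq : 0 < q) (z₀ : ℂ) (j : ℤ) :
    latZ q z₀ (j - 1) = latZ q z₀ j * (rp q (1 / 2))⁻¹ := by
  unfold latZ; rw [zpow_sub_one₀ (rp_ne_zero hq _)]; ring

theorem awD_iterate_latZ {q : ℝ} (hq : 0 < q) {z₀ : ℂ} (h0 : z₀ ≠ 0)
    (h1 : ∀ j, latZ q z₀ j ^ 2 ≠ 1) (k : ℕ) (f : ℂ → ℂ) (j : ℤ) :
    (awD q)^[k] f (jouk (latZ q z₀ j)) =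
      (latD (latStep q z₀) ^ k) (fun j => f (jouk (latZ q z₀ j))) j := by
  induction k generalizing f with
  | zero => rfl
  | succ k ih =>
    rw [Function.iterate_succ_apply, ih, pow_succ, Module.End.mul_apply]
    have : (fun i => awD q f (jouk (latZ q z₀ i))) =
        latD (latStep q z₀) (fun i => f (jouk (latZ q z₀ i))) := by
      funext i
      rw [awD_jouk hq f (latZ_ne_zero hq h0 i) (h1 i), latD_apply, latZ_add_one hq,
        latZ_sub_one hq]
      rfl
    rw [this]

/-- `(latD d)^k u` at `j` only involves `u` at the points `i` with `|i - j| ≤ k` and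
`i ≡ j + k` modulo `2`. -/
theorem latD_pow_eq_zero (d : ℤ → ℂ) (k : ℕ) (u : ℤ → ℂ) (j : ℤ)
    (h : ∀ i, |i - j| ≤ k → Even (i - j - k) → u i = 0) : (latD d ^ k) u j = 0 := by
  induction k generalizing u with
  | zero => simpa using h j (by simp) (by simp)
  | succ k ih =>
    rw [pow_succ, Module.End.mul_apply]
    apply ih
    intro i hi hi2
    rw [latD_apply, h (i + 1), h (i - 1)]
    · simp
    · rw [abs_le] at hi ⊢; push_cast; constructor <;> linarith
    · obtain ⟨r, hr⟩ := hi2; exact ⟨r - 1, by push_cast; linarith⟩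
    · rw [abs_le] at hi ⊢; push_cast; constructor <;> linarith
    · obtain ⟨r, hr⟩ := hi2; exact ⟨r, by push_cast; linarith⟩

/-- With even step sizes, `latD` exchanges even and odd functions. -/
theorem latD_pow_neg (d : ℤ → ℂ) (hd : ∀ j, d (-j) = d j) (k : ℕ) (u : ℤ → ℂ) (c : ℂ)
    (h : ∀ j, u (-j) = c * u j) (j : ℤ) :
    (latD d ^ k) u (-j) = c * (-1) ^ k * (latD d ^ k) u j := by
  induction k generalizing u c with
  | zero => simpa using h j
  | succ k ih =>
    rw [pow_succ (latD d), Module.End.mul_apply, ih _ (-c)]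
    · ring
    · intro i
      rw [latD_apply, latD_apply, hd, show -i + 1 = -(i - 1) by ring,
        show -i - 1 = -(i + 1) by ring, h, h]
      ring

theorem hasSum_latD_pow (d : ℤ → ℂ) (k : ℕ) (u : ℕ → ℤ → ℂ) (v : ℤ → ℂ)
    (h : ∀ j, HasSum (fun n => u n j) (v j)) (j : ℤ) :
    HasSum (fun n => (latD d ^ k) (u n) j) ((latD d ^ k) v j) := by
  induction k generalizing u v with
  | zero => simpa using h j
  | succ k ih =>
    simp only [pow_succ, Module.End.mul_apply]
    exact ih (fun n => latD d (u n)) _ fun i => ((h (i + 1)).sub (h (i - 1))).div_const _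

/-! ### The polynomials `ρ_n` -/

theorem rho_zero (q : ℝ) (x : ℂ) : rho q 0 x = 1 := by simp [rho]

theorem rho_one (q : ℝ) (x : ℂ) : rho q 1 x = 2 * x := by
  have h0 := eith_ne_zero x
  conv_rhs => rw [← jouk_eith x]
  simp only [rho, one_ne_zero, if_false, qPoch, jouk, tsub_self, Finset.range_zero,
    Finset.prod_empty]
  field_simp
  ring

/-- Passing from `n` to `n + 2` adds a first and a last factor to the product defining `ρ_n`. -/
theorem rho_add_two {q : ℝ} (hq : 0 < q) (n : ℕ) (x : ℂ) :
    rho q (n + 2) x = (4 * x ^ 2 - 2 + (q : ℂ) ^ n + ((q : ℂ) ^ n)⁻¹) * rho q n x := by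
  have h0 := eith_ne_zero x
  have hqc : (q : ℂ) ≠ 0 := by exact_mod_cast hq.ne'
  have hx : 4 * x ^ 2 = eith x ^ 2 + 2 + ((eith x)⁻¹) ^ 2 := by
    rw [← four_jouk_sq h0, jouk_eith]
  rw [hx]
  set z := eith x
  rcases n with _ | n
  · rw [rho_zero]
    have : rp q (2 - (0 + 2 : ℕ)) = 1 := by norm_num [rp_zero]
    unfold rho
    rw [this, if_neg (by omega), show eith x = z from rfl]
    simp only [qPoch, zero_add, Nat.add_one_sub_one, Finset.range_one, Finset.prod_singleton,
      pow_zero]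
    field_simp
    ring
  · have e1 : rp q (2 - (n + 1 + 2 : ℕ)) = ((q : ℂ) ^ (n + 1))⁻¹ := by
      rw [← rp_natCast, ← rp_neg hq]; congr 1; push_cast; ring
    have e2 : rp q (2 - (n + 1 : ℕ)) = ((q : ℂ) ^ (n + 1))⁻¹ * q ^ 2 := by
      rw [← rp_natCast, ← rp_neg hq, ← rp_natCast, ← rp_add hq]; congr 1; push_cast; ring
    unfold rho
    rw [if_neg (by omega), if_neg (by omega), e1, e2, show eith x = z from rfl]
    change (1 + z ^ 2) * qPoch _ _ (n + 1 + 1) * _ = _ * ((1 + z ^ 2) * qPoch _ _ n * _)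
    unfold qPoch
    rw [Finset.prod_range_succ, Finset.prod_range_succ']
    have : ∀ k, (1 - -((q : ℂ) ^ (n + 1))⁻¹ * z ^ 2 * ((q : ℂ) ^ 2) ^ (k + 1)) =
        1 - -(((q : ℂ) ^ (n + 1))⁻¹ * q ^ 2) * z ^ 2 * ((q : ℂ) ^ 2) ^ k := by
      intro k; ring
    simp only [this]
    set Q := ∏ k ∈ Finset.range n,
      (1 - -(((q : ℂ) ^ (n + 1))⁻¹ * q ^ 2) * z ^ 2 * ((q : ℂ) ^ 2) ^ k)
    have hp : (q : ℂ) ^ 2 * ((q : ℂ) ^ 2) ^ n = q ^ (n + 1) * q ^ (n + 1) := by ring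
    have hqn : (q : ℂ) ^ (n + 1) ≠ 0 := pow_ne_zero _ hqc
    rw [show ∀ a : ℂ, 1 - -(a * (q : ℂ) ^ 2) * z ^ 2 * ((q : ℂ) ^ 2) ^ n =
      1 + a * z ^ 2 * ((q : ℂ) ^ 2 * ((q : ℂ) ^ 2) ^ n) by intro a; ring, hp]
    generalize (q : ℂ) ^ (n + 1) = t at *
    simp only [pow_add z⁻¹ (n + 1) 2, inv_pow, pow_zero]
    field_simp
    ring

/-- The cofactor of `2x` in `ρ_{n+1}`. -/
def sig (q : ℝ) : ℕ → ℂ → ℂ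
  | 0, _ => 1
  | 1, x => 2 * x
  | n + 2, x => (4 * x ^ 2 - 2 + (q : ℂ) ^ (n + 1) + ((q : ℂ) ^ (n + 1))⁻¹) * sig q n x

theorem rho_succ {q : ℝ} (hq : 0 < q) (n : ℕ) (x : ℂ) : rho q (n + 1) x = 2 * x * sig q n x := by
  induction n using Nat.twoStepInduction with
  | zero => simp [rho_one, sig]
  | one => rw [rho_add_two hq, rho_zero, sig]; norm_num; ring
  | more n ih _ =>
    rw [show n + 2 + 1 = (n + 1) + 2 by ring, rho_add_two hq, ih, sig]; ring

/-- Shifting `z ↦ pz` with `p² = q^{±1}`: the shifted `ρ_{n+2}` and the unshifted `ρ_{n+1}`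
share the factor `sig n`. -/
theorem rho_jouk_mul {q : ℝ} (hq : 0 < q) {p z : ℂ} (hp : p ^ 2 = q ∨ p ^ 2 = (q : ℂ)⁻¹)
    (hz : z ≠ 0) (n : ℕ) :
    rho q (n + 2) (jouk (z * p)) =
      (z * p + (z * p)⁻¹) * (p ^ (n + 1) * z + (p ^ (n + 1) * z)⁻¹) * sig q n (jouk z) := by
  have hqc : (q : ℂ) ≠ 0 := by exact_mod_cast hq.ne'
  have hp0 : p ≠ 0 := by
    rintro rfl
    rcases hp with h | h
    · exact hqc (by simpa using h.symm)
    · exact inv_ne_zero hqc (by simpa using h.symm)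
  have hpz : z * p ≠ 0 := mul_ne_zero hz hp0
  have hs : ∀ m : ℕ, (q : ℂ) ^ m + ((q : ℂ) ^ m)⁻¹ = (p ^ m) ^ 2 + ((p ^ m) ^ 2)⁻¹ := by
    intro m
    rw [← pow_mul, mul_comm m 2, pow_mul]
    rcases hp with h | h <;> rw [h]
    rw [inv_pow, inv_inv, add_comm]
  induction n using Nat.twoStepInduction with
  | zero =>
    rw [rho_add_two hq, rho_zero, four_jouk_sq hpz, sig]
    field_simp
    ring
  | one =>
    rw [rho_add_two hq, rho_one, add_assoc, hs, sub_add_eq_add_sub, four_jouk_sq hpz, sig]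
    unfold jouk
    field_simp
    ring
  | more n ih _ =>
    rw [rho_add_two hq, ih, sig, add_assoc (_ - _), hs, add_assoc (_ - _), hs,
      four_jouk_sq hpz, four_jouk_sq hz]
    have hpn : p ^ n ≠ 0 := pow_ne_zero _ hp0
    rw [show p ^ (n + 2 + 1) = p ^ n * p ^ 3 by ring, show p ^ (n + 2) = p ^ n * p ^ 2 by ring,
      show p ^ (n + 1) = p ^ n * p by ring]
    generalize p ^ n = t at *
    field_simp
    ring

theorem rho_jouk_sub {q : ℝ} (hq : 0 < q) {z : ℂ} (hz : z ≠ 0) (n : ℕ) :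
    rho q (n + 1) (jouk (z * rp q (1 / 2))) - rho q (n + 1) (jouk (z * (rp q (1 / 2))⁻¹)) =
      (rp q (1 / 2) ^ (n + 1) - (rp q (1 / 2) ^ (n + 1))⁻¹) * (z - z⁻¹) * rho q n (jouk z) := by
  have hP := rp_ne_zero hq (1 / 2)
  have hP2 := rp_half_sq hq
  set P := rp q (1 / 2)
  rcases n with _ | n
  · rw [rho_one, rho_one, rho_zero]
    unfold jouk
    field_simp
    ring
  · rw [rho_jouk_mul hq (Or.inl hP2) hz, rho_jouk_mul hq (Or.inr (by rw [inv_pow, hP2])) hz,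
      rho_succ hq]
    have hpn : P ^ n ≠ 0 := pow_ne_zero _ hP
    simp only [inv_pow]
    rw [show P ^ (n + 1 + 1) = P ^ n * P ^ 2 by ring, show P ^ (n + 1) = P ^ n * P by ring]
    generalize sig q n (jouk z) = S
    unfold jouk
    generalize P ^ n = t at *
    field_simp
    ring

theorem rho_neg {q : ℝ} (hq : 0 < q) (n : ℕ) (x : ℂ) :
    rho q n (-x) = (-1) ^ n * rho q n x := by
  induction n using Nat.twoStepInduction with
  | zero => simp [rho_zero]
  | one => simp [rho_one]
  | more n ih _ => rw [rho_add_two hq, ih, rho_add_two hq]; ring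

theorem continuous_rho {q : ℝ} (hq : 0 < q) (n : ℕ) : Continuous (rho q n) := by
  induction n using Nat.twoStepInduction with
  | zero => rw [show rho q 0 = fun _ => 1 from funext (rho_zero q)]; exact continuous_const
  | one => rw [show rho q 1 = fun x => 2 * x from funext (rho_one q)]; fun_prop
  | more n ih _ =>
    rw [show rho q (n + 2) = fun x => (4 * x ^ 2 - 2 + (q : ℂ) ^ n + ((q : ℂ) ^ n)⁻¹) * rho q n x
      from funext (rho_add_two hq n)]
    fun_prop

theorem rho_succ_zero {q : ℝ} (hq : 0 < q) (n : ℕ) : rho q (n + 1) 0 = 0 := by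
  rw [rho_succ hq]; simp

theorem norm_q_lt_one {q : ℝ} (hq : 0 < q) (hq1 : q < 1) : ‖(q : ℂ)‖ < 1 := by
  rwa [Complex.norm_real, Real.norm_of_nonneg hq.le]

theorem one_sub_pow_ne_zero {p : ℂ} (hp : ‖p‖ < 1) (n : ℕ) : 1 - p ^ (n + 1) ≠ 0 := by
  intro h
  have h1 : ‖p ^ (n + 1)‖ = 1 := by rw [← sub_eq_zero.1 h]; simp
  rw [norm_pow] at h1
  exact absurd h1 (pow_lt_one₀ (norm_nonneg _) hp (by omega)).ne

theorem qPoch_succ (a p : ℂ) (n : ℕ) : qPoch a p (n + 1) = qPoch a p n * (1 - a * p ^ n) :=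
  Finset.prod_range_succ _ _

theorem qPoch_self_ne_zero {p : ℂ} (hp : ‖p‖ < 1) (n : ℕ) : qPoch p p n ≠ 0 := by
  refine Finset.prod_ne_zero_iff.2 fun k _ => ?_
  rw [← pow_succ']; exact one_sub_pow_ne_zero hp k

/-- The normalized polynomials `q^{n²/4} ρ_n(x) / (q; q)_n`, on which `γ⁻¹ 𝒟_q` lowers the
index; they are the coefficients of `w ↦ ℰ_q(x; w)`. -/
def eCoef (q : ℝ) (n : ℕ) (x : ℂ) : ℂ := rp q ((n : ℝ) ^ 2 / 4) * rho q n x / qPoch q q n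

theorem eCoef_zero (q : ℝ) (x : ℂ) : eCoef q 0 x = 1 := by simp [eCoef, rho_zero, rp_zero, qPoch]

theorem eCoef_one (q : ℝ) (x : ℂ) : eCoef q 1 x = rp q (1 / 4) * (2 * x) / (1 - q) := by
  simp [eCoef, rho_one, qPoch]

theorem eCoef_add_two {q : ℝ} (hq : 0 < q) (hq1 : q < 1) (n : ℕ) (x : ℂ) :
    (1 - (q : ℂ) ^ (n + 1)) * (1 - (q : ℂ) ^ (n + 2)) * eCoef q (n + 2) x =
      (4 * x ^ 2 * q ^ (n + 1) + q * (1 - (q : ℂ) ^ n) ^ 2) * eCoef q n x := by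
  have hn := norm_q_lt_one hq hq1
  have h1 := one_sub_pow_ne_zero hn n
  have h2 := one_sub_pow_ne_zero hn (n + 1)
  have h3 := qPoch_self_ne_zero hn n
  have hqn : (q : ℂ) ^ n ≠ 0 := pow_ne_zero _ (by exact_mod_cast hq.ne')
  have e : rp q (((n + 2 : ℕ) : ℝ) ^ 2 / 4) = rp q ((n : ℝ) ^ 2 / 4) * q ^ (n + 1) := by
    rw [← rp_natCast, ← rp_add hq]; congr 1; push_cast; ring
  unfold eCoef
  rw [e, rho_add_two hq, qPoch_succ, qPoch_succ, ← pow_succ', ← pow_succ']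
  field_simp
  ring

theorem gam_ne_zero {q : ℝ} (hq : 0 < q) (hq1 : q < 1) : gam q ≠ 0 := by
  have := one_sub_pow_ne_zero (norm_q_lt_one hq hq1) 0
  exact div_ne_zero (mul_ne_zero two_ne_zero (rp_ne_zero hq _)) (by simpa using this)

/-- On any lattice avoiding `x = ±1`, the operator `𝒟_q` maps `eCoef (n + 1)` to
`γ • eCoef n`. -/
theorem latD_eCoef_succ {q : ℝ} (hq : 0 < q) (hq1 : q < 1) {z₀ : ℂ} (h0 : z₀ ≠ 0)
    (h1 : ∀ j, latZ q z₀ j ^ 2 ≠ 1) (n : ℕ) :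
    latD (latStep q z₀) (fun j => eCoef q (n + 1) (jouk (latZ q z₀ j))) =
      gam q • fun j => eCoef q n (jouk (latZ q z₀ j)) := by
  ext j
  have hz := latZ_ne_zero hq h0 j
  have hz1 := h1 j
  rw [latD_apply, latZ_add_one hq, latZ_sub_one hq]
  rw [Pi.smul_apply, smul_eq_mul]
  unfold eCoef latStep
  rw [div_sub_div_same, ← mul_sub, rho_jouk_sub hq hz]
  generalize hzd : latZ q z₀ j = z at *
  have hn := norm_q_lt_one hq hq1
  have e : rp q (((n + 1 : ℕ) : ℝ) ^ 2 / 4) = rp q ((n : ℝ) ^ 2 / 4) * rp q (1 / 4) *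
      rp q (1 / 2) ^ n := by
    rw [show rp q (1 / 2) ^ n = rp q (n / 2) by
      unfold rp; rw [← Complex.ofReal_pow, ← Real.rpow_natCast, ← Real.rpow_mul hq.le]
      congr 2; ring]
    rw [← rp_add hq, ← rp_add hq]; congr 1; push_cast; ring
  have hP := rp_ne_zero hq (1 / 2)
  have hP2 := rp_half_sq hq
  have h2 := one_sub_pow_ne_zero hn n
  have h3 := one_sub_pow_ne_zero hn 0
  rw [e, qPoch_succ, ← pow_succ']
  unfold gam
  have hq1' := qPoch_self_ne_zero hn n
  generalize qPoch (q : ℂ) q n = Q at *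
  generalize rho q n (jouk z) = r
  rw [← hP2] at h2 h3 ⊢
  generalize rp q (1 / 2) = P at *
  have hzz : z - z⁻¹ ≠ 0 := by
    intro h; field_simp at h; exact hz1 (by linear_combination h)
  have hPn : P ^ n ≠ 0 := pow_ne_zero _ hP
  have h4 : (P ^ 2) ^ (n + 1) = (P ^ n) ^ 2 * P ^ 2 := by ring
  rw [h4] at h2 ⊢
  rw [zero_add, pow_one] at h3
  have h5 : P ^ 2 - 1 ≠ 0 := fun h => h3 (by linear_combination -h)
  rw [pow_succ P n]
  generalize P ^ n = t at *
  generalize rp q ((n : ℝ) ^ 2 / 4) = a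
  generalize rp q (1 / 4) = b
  have e3 : P - P⁻¹ = (P ^ 2 - 1) / P := by field_simp
  rw [e3]
  field_simp
  ring

theorem latD_eCoef_zero (q : ℝ) (z₀ : ℂ) (d : ℤ → ℂ) :
    latD d (fun j => eCoef q 0 (jouk (latZ q z₀ j))) = 0 := by
  ext j; simp [latD_apply, eCoef_zero]

theorem latD_pow_eCoef_add {q : ℝ} (hq : 0 < q) (hq1 : q < 1) {z₀ : ℂ} (h0 : z₀ ≠ 0)
    (h1 : ∀ j, latZ q z₀ j ^ 2 ≠ 1) (k n : ℕ) :
    (latD (latStep q z₀) ^ k) (fun j => eCoef q (n + k) (jouk (latZ q z₀ j))) =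
      gam q ^ k • fun j => eCoef q n (jouk (latZ q z₀ j)) := by
  induction k with
  | zero => simp
  | succ k ih =>
    rw [pow_succ, Module.End.mul_apply, ← add_assoc, latD_eCoef_succ hq hq1 h0 h1, map_smul, ih,
      smul_smul, pow_succ']

theorem latD_pow_eCoef_of_lt {q : ℝ} (hq : 0 < q) (hq1 : q < 1) {z₀ : ℂ} (h0 : z₀ ≠ 0)
    (h1 : ∀ j, latZ q z₀ j ^ 2 ≠ 1) {k n : ℕ} (h : n < k) :
    (latD (latStep q z₀) ^ k) (fun j => eCoef q n (jouk (latZ q z₀ j))) = 0 := by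
  obtain ⟨m, rfl⟩ := Nat.exists_eq_add_of_lt h
  have := latD_pow_eCoef_add hq hq1 h0 h1 n 0
  rw [zero_add] at this
  rw [show n + m + 1 = m + (1 + n) by ring, pow_add, pow_add, Module.End.mul_apply,
    Module.End.mul_apply, this, map_smul, pow_one, latD_eCoef_zero, smul_zero, map_zero]

/-! ### Expansion of the Cauchy kernel in the polynomials `ρ_n` -/

theorem cauchyKernel_expansion {q : ℝ} (hq : 0 < q) {s x : ℂ} (hs : s ≠ 0) (hsx : s ^ 2 - x ^ 2 ≠ 0)
    (N : ℕ) (h : ∀ n ≤ N + 1, rho q n s ≠ 0) :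
    (s - x)⁻¹ = ∑ k ∈ Finset.range N, 4 * s / rho q (k + 2) s * rho q k x +
      (rho q N x * (s / ((s ^ 2 - x ^ 2) * rho q N s)) +
        rho q (N + 1) x * (s / ((s ^ 2 - x ^ 2) * rho q (N + 1) s))) := by
  induction N with
  | zero =>
    have h1 : s - x ≠ 0 := fun h => hsx (by linear_combination (s + x) * h)
    simp only [Finset.range_zero, Finset.sum_empty, rho_zero, zero_add, rho_one]
    field_simp
    ring
  | succ N ih =>
    have h0 := h N (by omega)
    have h2 := h (N + 2) (by omega)
    rw [ih fun n hn => h n (by omega), Finset.sum_range_succ, show N + 1 + 1 = N + 2 from rfl]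
    have key : rho q N x * (s / ((s ^ 2 - x ^ 2) * rho q N s)) =
        4 * s / rho q (N + 2) s * rho q N x +
          rho q (N + 2) x * (s / ((s ^ 2 - x ^ 2) * rho q (N + 2) s)) := by
      rw [rho_add_two hq] at h2 ⊢
      rw [rho_add_two hq]
      have h3 := left_ne_zero_of_mul h2
      rw [show 4 * x ^ 2 - 2 + (q : ℂ) ^ N + ((q : ℂ) ^ N)⁻¹ =
        (4 * s ^ 2 - 2 + (q : ℂ) ^ N + ((q : ℂ) ^ N)⁻¹) - 4 * (s ^ 2 - x ^ 2) by ring]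
      generalize 4 * s ^ 2 - 2 + (q : ℂ) ^ N + ((q : ℂ) ^ N)⁻¹ = D at *
      generalize s ^ 2 - x ^ 2 = E at *
      field_simp
      ring
    rw [key]
    ring

/-- The coefficient of `ρ_k` in the interpolation of `f` as a contour integral over `‖s‖ = R`. -/
def contourCoef (q : ℝ) (f : ℂ → ℂ) (R : ℝ) (k : ℕ) : ℂ :=
  (2 * Real.pi * Complex.I : ℂ)⁻¹ • ∮ s in C(0, R), 4 * s / rho q (k + 2) s * f s

/-- The even factor of the remainder of the interpolation of `f` over `‖s‖ = R`. -/
def contourRem (q : ℝ) (f : ℂ → ℂ) (R : ℝ) (N : ℕ) (x : ℂ) : ℂ :=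
  (2 * Real.pi * Complex.I : ℂ)⁻¹ • ∮ s in C(0, R), s / ((s ^ 2 - x ^ 2) * rho q N s) * f s

theorem contourRem_congr_sq (q : ℝ) (f : ℂ → ℂ) (R : ℝ) (N : ℕ) {x y : ℂ} (h : x ^ 2 = y ^ 2) :
    contourRem q f R N x = contourRem q f R N y := by
  unfold contourRem; rw [h]

theorem sq_sub_sq_ne_zero_of_norm_lt {s x : ℂ} (h : ‖x‖ < ‖s‖) : s ^ 2 - x ^ 2 ≠ 0 := by
  intro h1
  have h2 : ‖s‖ ^ 2 = ‖x‖ ^ 2 := by rw [← norm_pow, ← norm_pow, sub_eq_zero.1 h1]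
  nlinarith [norm_nonneg x]

theorem interpolation_formula {q : ℝ} (hq : 0 < q) {f : ℂ → ℂ} (hf : Differentiable ℂ f) {R : ℝ}
    (hR : 0 < R) (N : ℕ) (h : ∀ s : ℂ, ‖s‖ = R → ∀ n ≤ N + 1, rho q n s ≠ 0) {x : ℂ}
    (hx : ‖x‖ < R) :
    f x = ∑ k ∈ Finset.range N, contourCoef q f R k * rho q k x +
      (rho q N x * contourRem q f R N x + rho q (N + 1) x * contourRem q f R (N + 1) x) := by
  have hsph : ∀ s ∈ Metric.sphere (0 : ℂ) R, ‖s‖ = R := fun s hs => by simpa using hs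
  have hcauchy := hf.differentiableOn (s := Metric.closedBall 0 R)
    |>.circleIntegral_sub_inv_smul (w := x) (by simpa using hx)
  have hpi : (2 * Real.pi * Complex.I : ℂ) ≠ 0 := by
    simp [Real.pi_ne_zero, Complex.I_ne_zero]
  have hfc : ContinuousOn f (Metric.sphere 0 R) := hf.continuous.continuousOn
  have hrc : ∀ n, ContinuousOn (rho q n) (Metric.sphere 0 R) :=
    fun n => (continuous_rho hq n).continuousOn
  have hI1 : ∀ k ∈ Finset.range N,
      CircleIntegrable (fun s => rho q k x * (4 * s / rho q (k + 2) s * f s)) 0 R := by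
    intro k hk
    refine ContinuousOn.circleIntegrable hR.le (continuousOn_const.mul
      (ContinuousOn.mul (ContinuousOn.div (by fun_prop) (hrc _) ?_) hfc))
    intro s hs
    exact h s (hsph s hs) _ (by have := Finset.mem_range.1 hk; omega)
  have hI2 : ∀ n ≤ N + 1, CircleIntegrable
      (fun s => rho q n x * (s / ((s ^ 2 - x ^ 2) * rho q n s) * f s)) 0 R := by
    intro n hn
    refine ContinuousOn.circleIntegrable hR.le (continuousOn_const.mul
      (ContinuousOn.mul (ContinuousOn.div (by fun_prop)
        (ContinuousOn.mul (by fun_prop) (hrc _)) ?_) hfc))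
    intro s hs
    exact mul_ne_zero (sq_sub_sq_ne_zero_of_norm_lt (by rwa [hsph s hs])) (h s (hsph s hs) _ hn)
  have hIs : CircleIntegrable (fun s => ∑ k ∈ Finset.range N,
      rho q k x * (4 * s / rho q (k + 2) s * f s)) 0 R := by
    have := CircleIntegrable.sum (Finset.range N) hI1
    convert this using 1
    ext s; simp
  have hI3 : CircleIntegrable (fun s => rho q N x * (s / ((s ^ 2 - x ^ 2) * rho q N s) * f s) +
      rho q (N + 1) x * (s / ((s ^ 2 - x ^ 2) * rho q (N + 1) s) * f s)) 0 R :=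
    (hI2 N (by omega)).add (hI2 (N + 1) le_rfl)
  have hcongr : (∮ s in C(0, R), (s - x)⁻¹ • f s) = ∮ s in C(0, R),
      ((∑ k ∈ Finset.range N, rho q k x * (4 * s / rho q (k + 2) s * f s)) +
        (rho q N x * (s / ((s ^ 2 - x ^ 2) * rho q N s) * f s) +
          rho q (N + 1) x * (s / ((s ^ 2 - x ^ 2) * rho q (N + 1) s) * f s))) := by
    refine circleIntegral.integral_congr hR.le fun s hs => ?_
    have hs' := hsph s hs
    have hs0 : s ≠ 0 := by rw [← norm_pos_iff, hs']; exact hR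
    simp only [smul_eq_mul]
    rw [cauchyKernel_expansion hq hs0 (sq_sub_sq_ne_zero_of_norm_lt (by rwa [hs'])) N (h s hs'),
      add_mul, Finset.sum_mul]
    congr 1
    · exact Finset.sum_congr rfl fun k _ => by ring
    · ring
  rw [hcongr, circleIntegral.integral_add hIs hI3,
    circleIntegral.integral_add (hI2 N (by omega)) (hI2 (N + 1) le_rfl),
    circleIntegral.integral_fun_sum hI1] at hcauchy
  simp only [circleIntegral.integral_const_mul] at hcauchy
  unfold contourCoef contourRem
  simp only [smul_eq_mul] at hcauchy ⊢
  apply mul_left_cancel₀ hpi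
  rw [← hcauchy, mul_add, Finset.mul_sum, mul_add]
  congr 1
  · exact Finset.sum_congr rfl fun k _ => by field_simp
  · congr 1 <;> field_simp

/-! ### The interpolation nodes -/

theorem latZ_I_sq {q : ℝ} (hq : 0 < q) (j : ℤ) : latZ q Complex.I j ^ 2 = -(q : ℂ) ^ j := by
  unfold latZ
  rw [mul_pow, Complex.I_sq, ← zpow_natCast (_ ^ j), ← zpow_mul, mul_comm j, zpow_mul, zpow_natCast,
    rp_half_sq hq]
  ring

/-- The lattice through `0` avoids `x = ±1`: its points have `z² < 0`. -/
theorem latZ_I_sq_ne_one {q : ℝ} (hq : 0 < q) (j : ℤ) : latZ q Complex.I j ^ 2 ≠ 1 := by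
  rw [latZ_I_sq hq]
  have : 0 < q ^ j := zpow_pos hq j
  intro h
  have h2 : -q ^ j = 1 := by exact_mod_cast h
  linarith

theorem jouk_latZ_I_neg (q : ℝ) (j : ℤ) :
    jouk (latZ q Complex.I (-j)) = -jouk (latZ q Complex.I j) := by
  unfold jouk latZ
  rw [zpow_neg, mul_inv, mul_inv, inv_inv, Complex.inv_I]
  ring

theorem latStep_I_neg (q : ℝ) (j : ℤ) : latStep q Complex.I (-j) = latStep q Complex.I j := by
  unfold latStep latZ
  rw [zpow_neg, mul_inv, mul_inv, inv_inv, Complex.inv_I]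
  ring

theorem jouk_latZ_I_zero (q : ℝ) : jouk (latZ q Complex.I 0) = 0 := by
  simp [jouk, latZ]

theorem four_mul_node_sq {q : ℝ} (hq : 0 < q) (j : ℤ) :
    4 * jouk (latZ q Complex.I j) ^ 2 =
      2 - ((q : ℂ) ^ j.natAbs + ((q : ℂ) ^ j.natAbs)⁻¹) := by
  rw [four_jouk_sq (latZ_ne_zero hq Complex.I_ne_zero j), inv_pow, latZ_I_sq hq]
  have h : (q : ℂ) ^ j + ((q : ℂ) ^ j)⁻¹ = (q : ℂ) ^ j.natAbs + ((q : ℂ) ^ j.natAbs)⁻¹ := by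
    obtain ⟨n, rfl | rfl⟩ := j.eq_nat_or_neg
    · simp
    · simp [add_comm]
  rw [← h, inv_neg]
  ring

/-- `ρ_n` vanishes at the node `x_j` when `n ≡ j` modulo `2` and `n ≥ |j| + 2`. -/
theorem rho_node_eq_zero {q : ℝ} (hq : 0 < q) (j : ℤ) (m : ℕ) :
    rho q (j.natAbs + 2 + 2 * m) (jouk (latZ q Complex.I j)) = 0 := by
  induction m with
  | zero => rw [mul_zero, add_zero, rho_add_two hq, four_mul_node_sq hq]; ring
  | succ m ih =>
    rw [show j.natAbs + 2 + 2 * (m + 1) = (j.natAbs + 2 + 2 * m) + 2 by ring, rho_add_two hq, ih,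
      mul_zero]

theorem norm_two_sub_le {q : ℝ} (hq : 0 < q) (hq1 : q < 1) (n : ℕ) :
    ‖2 - ((q : ℂ) ^ n + ((q : ℂ) ^ n)⁻¹)‖ ≤ (q ^ n)⁻¹ := by
  have h0 : 0 < q ^ n := pow_pos hq n
  have h1 : q ^ n ≤ 1 := pow_le_one₀ hq.le hq1.le
  have h2 : 1 ≤ (q ^ n)⁻¹ := (one_le_inv₀ h0).2 h1
  have : (2 - ((q : ℂ) ^ n + ((q : ℂ) ^ n)⁻¹)) = ((2 - (q ^ n + (q ^ n)⁻¹) : ℝ) : ℂ) := by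
    push_cast; ring
  rw [this, Complex.norm_real, Real.norm_eq_abs, abs_le]
  have h3 : q ^ n * (q ^ n)⁻¹ = 1 := mul_inv_cancel₀ h0.ne'
  constructor <;> nlinarith [mul_nonneg (sub_nonneg.2 h1) (sub_nonneg.2 h2)]

theorem norm_node_lt {q : ℝ} (hq : 0 < q) (hq1 : q < 1) {L : ℕ} {T : ℝ} (hT : 0 < T)
    (hTL : T ^ 2 * q ^ L = 1) (j : ℤ) (hj : j.natAbs < L) :
    ‖jouk (latZ q Complex.I j)‖ < T / 2 := by
  have h := norm_two_sub_le hq hq1 j.natAbs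
  rw [← four_mul_node_sq hq, norm_mul, norm_pow] at h
  have h1 : (q ^ j.natAbs)⁻¹ < T ^ 2 := by
    rw [inv_lt_iff_one_lt_mul₀ (pow_pos hq _), ← hTL]
    exact mul_lt_mul_of_pos_left (pow_lt_pow_right_of_lt_one₀ hq hq1 hj) (by positivity)
  have h2 : ‖(4 : ℂ)‖ = 4 := by simp
  rw [h2] at h
  refine lt_of_pow_lt_pow_left₀ 2 (by positivity) ?_
  rw [div_pow]
  linarith

/-- The finite products `(q; q)_n` are bounded below by the positive number `(q; q)_∞`. -/
theorem exists_pos_le_prod_one_sub_pow {q : ℝ} (hq : 0 < q) (hq1 : q < 1) :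
    ∃ c : ℝ, 0 < c ∧ ∀ n : ℕ, c ≤ ∏ i ∈ Finset.range n, (1 - q ^ (i + 1)) := by
  have hs : Summable fun i : ℕ => ‖-q ^ (i + 1)‖ := by
    simp only [norm_neg, norm_pow, Real.norm_of_nonneg hq.le]
    exact (summable_nat_add_iff 1).2 (summable_geometric_of_lt_one hq.le hq1)
  have hpos : ∀ i : ℕ, 0 < 1 + -q ^ (i + 1) := fun i => by
    linarith [pow_lt_one₀ hq.le hq1 (n := i + 1) (by omega)]
  have hne := tprod_one_add_ne_zero_of_summable (fun i => (hpos i).ne') hs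
  have hm := (multipliable_one_add_of_summable hs).hasProd.tendsto_prod_nat
  have hanti : Antitone fun n : ℕ => ∏ i ∈ Finset.range n, (1 + -q ^ (i + 1)) := by
    refine antitone_nat_of_succ_le fun n => ?_
    rw [Finset.prod_range_succ]
    refine mul_le_of_le_one_right (Finset.prod_nonneg fun i _ => (hpos i).le) ?_
    have : 0 < q ^ (n + 1) := pow_pos hq _
    linarith
  have hle := hanti.le_of_tendsto hm
  refine ⟨_, lt_of_le_of_ne ?_ hne.symm, fun n => ?_⟩
  · exact ge_of_tendsto' hm fun n => Finset.prod_nonneg fun i _ => (hpos i).le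
  · simpa [sub_eq_add_neg] using hle n

theorem prod_le_norm_rho {q : ℝ} (hq : 0 < q) (hq1 : q < 1) {L : ℕ} {T : ℝ} (hT : 0 < T)
    (hTL : T ^ 2 * q ^ L = 1) {s : ℂ} (hs : ‖s‖ = T / 2) (n : ℕ) (hn : n ≤ L) :
    T ^ n * ∏ i ∈ Finset.range n, (1 - q ^ (L - i)) ≤ ‖rho q n s‖ := by
  -- the products contain the factors of both parities, all at most `1`, although `ρ_n` only needs
  -- those with `i ≡ n` modulo `2`
  have hf : ∀ m, 0 ≤ 1 - q ^ m := fun m => sub_nonneg.2 (pow_le_one₀ hq.le hq1.le)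
  have hf1 : ∀ m, 1 - q ^ m ≤ 1 := fun m => by linarith [pow_pos hq m]
  induction n using Nat.twoStepInduction with
  | zero => simp [rho_zero]
  | one =>
    rw [rho_one, norm_mul, hs]
    have := mul_le_mul_of_nonneg_left (hf1 L) hT.le
    simp
    linarith
  | more n ih _ =>
    have h4 : ‖4 * s ^ 2‖ = T ^ 2 := by rw [norm_mul, norm_pow, hs]; norm_num; ring
    have h5 : (q ^ n)⁻¹ = T ^ 2 * q ^ (L - n) := by
      have : q ^ L = q ^ (L - n) * q ^ n := by rw [← pow_add]; congr 1; omega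
      rw [this, ← mul_assoc] at hTL
      exact (eq_inv_of_mul_eq_one_left hTL).symm
    have h6 : T ^ 2 * (1 - q ^ (L - n)) ≤ ‖4 * s ^ 2 - 2 + (q : ℂ) ^ n + ((q : ℂ) ^ n)⁻¹‖ := by
      have h7 := norm_sub_norm_le (4 * s ^ 2) (2 - ((q : ℂ) ^ n + ((q : ℂ) ^ n)⁻¹))
      have h8 := norm_two_sub_le hq hq1 n
      rw [show 4 * s ^ 2 - (2 - ((q : ℂ) ^ n + ((q : ℂ) ^ n)⁻¹)) =
        4 * s ^ 2 - 2 + (q : ℂ) ^ n + ((q : ℂ) ^ n)⁻¹ by ring, h4] at h7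
      rw [h5] at h8
      linarith
    have hP : 0 ≤ ∏ i ∈ Finset.range n, (1 - q ^ (L - i)) := Finset.prod_nonneg fun i _ => hf _
    rw [rho_add_two hq, norm_mul, Finset.prod_range_succ, Finset.prod_range_succ]
    calc T ^ (n + 2) * ((∏ i ∈ Finset.range n, (1 - q ^ (L - i))) * (1 - q ^ (L - n)) *
          (1 - q ^ (L - (n + 1))))
        ≤ T ^ (n + 2) * ((∏ i ∈ Finset.range n, (1 - q ^ (L - i))) * (1 - q ^ (L - n))) :=
          mul_le_mul_of_nonneg_left (mul_le_of_le_one_right (mul_nonneg hP (hf _)) (hf1 _))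
            (by positivity)
      _ = (T ^ 2 * (1 - q ^ (L - n))) * (T ^ n * ∏ i ∈ Finset.range n, (1 - q ^ (L - i))) := by
          ring
      _ ≤ _ := mul_le_mul h6 (ih (by omega)) (mul_nonneg (by positivity) hP) (norm_nonneg _)

/-- On the circle of radius `q^{-L/2} / 2` the polynomials `ρ_n`, `n ≤ L`, have the size of their
leading term. -/
theorem exists_mul_pow_le_norm_rho {q : ℝ} (hq : 0 < q) (hq1 : q < 1) :
    ∃ c : ℝ, 0 < c ∧ ∀ (L : ℕ) (T : ℝ), 0 < T → T ^ 2 * q ^ L = 1 → ∀ s : ℂ, ‖s‖ = T / 2 →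
      ∀ n ≤ L, c * T ^ n ≤ ‖rho q n s‖ := by
  obtain ⟨c, hc, hcp⟩ := exists_pos_le_prod_one_sub_pow hq hq1
  refine ⟨c, hc, fun L T hT hTL s hs n hn => ?_⟩
  refine le_trans ?_ (prod_le_norm_rho hq hq1 hT hTL hs n hn)
  rw [mul_comm]
  refine mul_le_mul_of_nonneg_left ((hcp L).trans ?_) (by positivity)
  have : ∏ i ∈ Finset.range L, (1 - q ^ (i + 1)) = ∏ i ∈ Finset.range L, (1 - q ^ (L - i)) := by
    rw [← Finset.prod_range_reflect]
    refine Finset.prod_congr rfl fun i hi => ?_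
    have := Finset.mem_range.1 hi
    congr 2; omega
  rw [this]
  refine Finset.prod_le_prod_of_subset_of_le_one (Finset.range_subset_range.2 hn)
    (fun i _ => sub_nonneg.2 (pow_le_one₀ hq.le hq1.le)) fun i _ _ => ?_
  linarith [pow_pos hq (L - i)]

/-! ### Identification of the coefficients -/

/-- `𝒟_q^k` at `0` annihilates `ρ_M · h` for even `h` and `k < M`: when `k ≡ M` modulo `2` the
polynomial `ρ_M` vanishes at all the nodes involved, otherwise the parities do not match. -/
theorem latD_pow_rho_mul_even {q : ℝ} (hq : 0 < q) (h : ℂ → ℂ) (hh : ∀ x, h (-x) = h x) {k M : ℕ}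
    (hk : k < M) :
    (latD (latStep q Complex.I) ^ k)
      (fun j => rho q M (jouk (latZ q Complex.I j)) * h (jouk (latZ q Complex.I j))) 0 = 0 := by
  rcases Nat.even_or_odd (M + k) with he | ho
  · apply latD_pow_eq_zero
    intro i hi hi2
    have : ∃ m, M = i.natAbs + 2 + 2 * m := by
      obtain ⟨r, hr⟩ := he
      obtain ⟨t, ht⟩ := hi2
      refine ⟨(M - i.natAbs - 2) / 2, ?_⟩
      rw [sub_zero] at hi ht
      have := Int.natCast_natAbs i
      rcases abs_cases i with ⟨h1, _⟩ | ⟨h1, _⟩ <;> omega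
    obtain ⟨m, rfl⟩ := this
    rw [rho_node_eq_zero hq, zero_mul]
  · have := latD_pow_neg (latStep q Complex.I) (latStep_I_neg q) k
      (fun j => rho q M (jouk (latZ q Complex.I j)) * h (jouk (latZ q Complex.I j))) ((-1) ^ M)
      (fun j => by simp only [jouk_latZ_I_neg, rho_neg hq, hh]; ring) 0
    rw [← pow_add, ho.neg_one_pow, neg_zero] at this
    linear_combination (1 / 2) * this

theorem eCoef_succ_zero {q : ℝ} (hq : 0 < q) (n : ℕ) : eCoef q (n + 1) 0 = 0 := by
  simp [eCoef, rho_succ_zero hq]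

theorem latD_pow_eCoef_node_zero {q : ℝ} (hq : 0 < q) (hq1 : q < 1) (k n : ℕ) :
    (latD (latStep q Complex.I) ^ k) (fun j => eCoef q n (jouk (latZ q Complex.I j))) 0 =
      if n = k then gam q ^ k else 0 := by
  rcases lt_or_ge n k with h | h
  · rw [latD_pow_eCoef_of_lt hq hq1 Complex.I_ne_zero (latZ_I_sq_ne_one hq) h, if_neg h.ne]; rfl
  · obtain ⟨m, rfl⟩ := Nat.exists_eq_add_of_le' h
    rw [latD_pow_eCoef_add hq hq1 Complex.I_ne_zero (latZ_I_sq_ne_one hq), Pi.smul_apply,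
      jouk_latZ_I_zero]
    rcases m with _ | m
    · simp [eCoef_zero]
    · rw [eCoef_succ_zero hq, if_neg (by omega), smul_zero]

/-- The normalized derivatives `γ^{-k} 𝒟_q^k f(0)`. -/
def awCoef (q : ℝ) (f : ℂ → ℂ) (k : ℕ) : ℂ := (gam q ^ k)⁻¹ * (awD q)^[k] f 0

theorem awD_iterate_zero {q : ℝ} (hq : 0 < q) (f : ℂ → ℂ) (k : ℕ) :
    (awD q)^[k] f 0 =
      (latD (latStep q Complex.I) ^ k) (fun j => f (jouk (latZ q Complex.I j))) 0 := by
  rw [← awD_iterate_latZ hq Complex.I_ne_zero (latZ_I_sq_ne_one hq), jouk_latZ_I_zero]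

theorem contourCoef_mul_rho {q : ℝ} (hq : 0 < q) (hq1 : q < 1) {f : ℂ → ℂ}
    (hf : Differentiable ℂ f) {T : ℝ} (hT : 0 < T) {L N : ℕ} (hTL : T ^ 2 * q ^ L = 1) (hNL : N ≤ L)
    (h : ∀ s : ℂ, ‖s‖ = T / 2 → ∀ n ≤ N + 1, rho q n s ≠ 0) {k : ℕ} (hk : k < N) (x : ℂ) :
    contourCoef q f (T / 2) k * rho q k x = awCoef q f k * eCoef q k x := by
  set a : ℕ → ℂ := fun i => contourCoef q f (T / 2) i * (qPoch q q i / rp q ((i : ℝ) ^ 2 / 4))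
    with ha
  have hae : ∀ i y, contourCoef q f (T / 2) i * rho q i y = a i * eCoef q i y := by
    intro i y
    have h1 := qPoch_self_ne_zero (norm_q_lt_one hq hq1) i
    have h2 := rp_ne_zero hq ((i : ℝ) ^ 2 / 4)
    simp only [ha, eCoef]
    field_simp
  -- all nodes entering `𝒟_q^k` at `0` lie inside the circle, so `f` may be replaced by its
  -- interpolation formula there
  have key : (awD q)^[k] f 0 = a k * gam q ^ k := by
    rw [awD_iterate_zero hq]
    set D := latD (latStep q Complex.I) ^ k with hD
    set X : ℤ → ℂ := fun j => jouk (latZ q Complex.I j) with hX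
    have hrem : ∀ M, ∀ y, contourRem q f (T / 2) M (-y) = contourRem q f (T / 2) M y :=
      fun M y => contourRem_congr_sq q f _ M (neg_sq y)
    have hz : D ((fun j => f (X j)) - ((∑ i ∈ Finset.range N, a i • fun j => eCoef q i (X j)) +
        ((fun j => rho q N (X j) * contourRem q f (T / 2) N (X j)) +
          fun j => rho q (N + 1) (X j) * contourRem q f (T / 2) (N + 1) (X j)))) 0 = 0 := by
      apply latD_pow_eq_zero
      intro i hi _
      have hi' : i.natAbs < L := by
        have := Int.natCast_natAbs i
        rw [sub_zero] at hi; omega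
      have hx := norm_node_lt hq hq1 hT hTL i hi'
      have := interpolation_formula hq hf (by positivity) N h hx
      simp only [hae] at this
      simp only [Pi.sub_apply, Pi.add_apply, Finset.sum_apply, Pi.smul_apply, smul_eq_mul]
      exact sub_eq_zero.2 this
    rw [map_sub, map_add, map_add, map_sum, Pi.sub_apply, Pi.add_apply, Pi.add_apply,
      latD_pow_rho_mul_even hq _ (hrem _) hk, latD_pow_rho_mul_even hq _ (hrem _) (by omega),
      Finset.sum_apply] at hz
    simp only [map_smul, Pi.smul_apply, smul_eq_mul] at hz
    simp only [hD, hX, latD_pow_eCoef_node_zero hq hq1] at hz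
    rw [Finset.sum_eq_single k (fun b _ hb => by simp [hb])
      (fun hb => absurd (Finset.mem_range.2 hk) hb)] at hz
    simp only [if_true, add_zero] at hz
    exact sub_eq_zero.1 hz
  rw [hae, awCoef, key]
  have := pow_ne_zero k (gam_ne_zero hq hq1)
  field_simp

/-! ### Growth estimates -/

/-- A two-step recursion whose factors are eventually at most `1` in norm has bounded solutions. -/
theorem exists_norm_le_of_two_step {a t : ℕ → ℂ} (h : ∀ n, a (n + 2) = t n * a n)
    (ht : ∀ᶠ n in atTop, ‖t n‖ ≤ 1) : ∃ C : ℝ, 0 < C ∧ ∀ n, ‖a n‖ ≤ C := by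
  obtain ⟨n0, hn0⟩ := eventually_atTop.1 ht
  refine ⟨1 + ∑ i ∈ Finset.range (n0 + 2), ‖a i‖, by positivity, fun n => ?_⟩
  have hlow : ∀ m < n0 + 2, ‖a m‖ ≤ 1 + ∑ i ∈ Finset.range (n0 + 2), ‖a i‖ := fun m hm => by
    have := Finset.single_le_sum (f := fun i => ‖a i‖) (fun i _ => norm_nonneg _)
      (Finset.mem_range.2 hm)
    linarith
  induction n using Nat.twoStepInduction with
  | zero => exact hlow 0 (by omega)
  | one => exact hlow 1 (by omega)
  | more n ih _ =>
    by_cases hn : n < n0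
    · exact hlow _ (by omega)
    · rw [h, norm_mul]
      exact (mul_le_of_le_one_left (norm_nonneg _) (hn0 n (by omega))).trans ih

theorem tendsto_q_pow {q : ℝ} (hq : 0 < q) (hq1 : q < 1) :
    Tendsto (fun n : ℕ => (q : ℂ) ^ n) atTop (𝓝 0) :=
  tendsto_pow_atTop_nhds_zero_of_norm_lt_one (norm_q_lt_one hq hq1)

theorem exists_norm_eCoef_le {q : ℝ} (hq : 0 < q) (hq1 : q < 1) (x : ℂ) :
    ∃ C : ℝ, 0 < C ∧ ∀ n, ‖eCoef q n x‖ ≤ C := by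
  have hn := norm_q_lt_one hq hq1
  refine exists_norm_le_of_two_step (t := fun n =>
    (4 * x ^ 2 * (q : ℂ) ^ (n + 1) + q * (1 - (q : ℂ) ^ n) ^ 2) /
      ((1 - (q : ℂ) ^ (n + 1)) * (1 - (q : ℂ) ^ (n + 2)))) (fun n => ?_) ?_
  · have h1 := one_sub_pow_ne_zero hn n
    have h2 := one_sub_pow_ne_zero hn (n + 1)
    have := eCoef_add_two hq hq1 n x
    rw [div_mul_eq_mul_div, eq_div_iff (mul_ne_zero h1 h2), ← this]
    ring
  · have h0 := tendsto_q_pow hq hq1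
    have h1 := (tendsto_add_atTop_iff_nat 1).2 h0
    have h2 := (tendsto_add_atTop_iff_nat 2).2 h0
    have h3 := (((h1.const_mul (4 * x ^ 2)).add
      (((h0.const_sub 1).pow 2).const_mul (q : ℂ))).div
      ((h1.const_sub 1).mul (h2.const_sub 1)) (by simp)).norm
    simp only [mul_zero, sub_zero, one_pow, mul_one, zero_add, div_one] at h3
    exact (h3.eventually (gt_mem_nhds hn)).mono fun n hn => hn.le

theorem norm_qPoch_self_le_one {q : ℝ} (hq : 0 < q) (hq1 : q < 1) (n : ℕ) :
    ‖qPoch q q n‖ ≤ 1 := by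
  unfold qPoch
  rw [norm_prod]
  refine Finset.prod_le_one (fun i _ => norm_nonneg _) fun i _ => ?_
  have h1 : q ^ (i + 1) ≤ 1 := pow_le_one₀ hq.le hq1.le
  have h2 : 0 < q ^ (i + 1) := pow_pos hq _
  rw [← pow_succ', show (1 : ℂ) - (q : ℂ) ^ (i + 1) = ((1 - q ^ (i + 1) : ℝ) : ℂ) by push_cast; rfl,
    Complex.norm_real, Real.norm_eq_abs, abs_le]
  constructor <;> linarith

theorem exists_norm_rho_le {q : ℝ} (hq : 0 < q) (hq1 : q < 1) (x : ℂ) :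
    ∃ C : ℝ, 0 < C ∧ ∀ n : ℕ, ‖rho q n x‖ ≤ C * q ^ (-((n : ℝ) ^ 2 / 4)) := by
  obtain ⟨C, hC, h⟩ := exists_norm_eCoef_le hq hq1 x
  refine ⟨C, hC, fun n => ?_⟩
  have h1 : rho q n x = eCoef q n x * qPoch q q n * rp q (-((n : ℝ) ^ 2 / 4)) := by
    have h1 := qPoch_self_ne_zero (norm_q_lt_one hq hq1) n
    have h2 := rp_ne_zero hq ((n : ℝ) ^ 2 / 4)
    rw [rp_neg hq, eCoef]
    field_simp
  rw [h1, norm_mul, norm_mul, norm_rp hq]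
  refine mul_le_mul_of_nonneg_right ?_ (Real.rpow_nonneg hq.le _)
  exact (mul_le_of_le_one_right (norm_nonneg _) (norm_qPoch_self_le_one hq hq1 n)).trans (h n)

/-- The growth hypothesis, evaluated on the circles of radius `q^{-L/2} / 2`. For the critical order
the type enters through `ln² (q^{-L/2} / 2)`, whose cross term gives the factor `2^{-L}`. -/
theorem exists_norm_le_on_circles {q : ℝ} (hq : 0 < q) (hq1 : q < 1) {f : ℂ → ℂ}
    (hgrowth : (∃ k α : ℝ, k < 2 * Real.log q⁻¹ ∧ QExpGrowth q f k α) ∨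
      (∃ α : ℝ, α < 2 * Real.log 2 / Real.log q⁻¹ ∧ QExpGrowth q f (2 * Real.log q⁻¹) α)) :
    ∃ K r : ℝ, 0 < K ∧ 0 < r ∧ r < 1 ∧ ∀ (L : ℕ) (s : ℂ), ‖s‖ = q ^ (-(L : ℝ) / 2) / 2 →
      ‖f s‖ ≤ K * r ^ L * q ^ (-((L : ℝ) ^ 2 / 4)) := by
  have hl : 0 < Real.log q⁻¹ := Real.log_pos ((one_lt_inv₀ hq).2 hq1)
  have hlq : Real.log q = -Real.log q⁻¹ := by rw [Real.log_inv, neg_neg]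
  set l := Real.log q⁻¹ with hldef
  have hlog2 : 0 < Real.log 2 := Real.log_pos one_lt_two
  have hlogs : ∀ L : ℕ, Real.log (q ^ (-(L : ℝ) / 2) / 2) = l * L / 2 - Real.log 2 := fun L => by
    rw [Real.log_div (Real.rpow_pos_of_pos hq _).ne' two_ne_zero, Real.log_rpow hq, hlq]; ring
  have main : ∀ (d k α C : ℝ), 0 < d → QExpGrowth q f k α →
      (∀ L : ℕ, α * (l * L / 2 - Real.log 2) + k * (l * L / 2 - Real.log 2) ^ 2 / (2 * l ^ 2) ≤
        C - d * L + l * (L : ℝ) ^ 2 / 4) →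
      ∃ K r : ℝ, 0 < K ∧ 0 < r ∧ r < 1 ∧ ∀ (L : ℕ) (s : ℂ), ‖s‖ = q ^ (-(L : ℝ) / 2) / 2 →
        ‖f s‖ ≤ K * r ^ L * q ^ (-((L : ℝ) ^ 2 / 4)) := by
    rintro d k α C hd ⟨K, hK, hb⟩ hL
    refine ⟨K * Real.exp C, Real.exp (-d), by positivity, Real.exp_pos _,
      Real.exp_zero ▸ Real.exp_lt_exp.2 (by linarith), fun L s hs => ?_⟩
    have hs0 : 0 < ‖s‖ := by
      rw [hs]; exact div_pos (Real.rpow_pos_of_pos hq _) two_pos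
    refine (hb s (norm_pos_iff.1 hs0)).le.trans ?_
    rw [Real.rpow_def_of_pos hs0, Real.rpow_def_of_pos hq, hs, hlogs, hlq, ← Real.exp_nat_mul,
      mul_assoc, mul_assoc, mul_assoc, ← Real.exp_add, ← Real.exp_add, ← Real.exp_add]
    refine mul_le_mul_of_nonneg_left (Real.exp_le_exp.2 ?_) hK.le
    have := hL L
    rw [neg_sq]
    linarith
  rcases hgrowth with ⟨k, α, hk, hg⟩ | ⟨α, hα, hg⟩
  · set m := (2 * l - k) / (2 * l ^ 2) with hm
    have hm0 : 0 < m := div_pos (by linarith) (by positivity)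
    refine main (Real.log 2) k α (α ^ 2 / (4 * m) + Real.log 2 ^ 2 / l) hlog2 hg fun L => ?_
    set u := l * L / 2 - Real.log 2 with hu
    -- below the critical order the surplus `m u²` absorbs any power `e^{αu}`
    have h1 : k * u ^ 2 / (2 * l ^ 2) = u ^ 2 / l - m * u ^ 2 := by
      rw [hm]; field_simp; ring
    have h2 : u ^ 2 / l = l * (L : ℝ) ^ 2 / 4 - Real.log 2 * L + Real.log 2 ^ 2 / l := by
      rw [hu]; field_simp; ring
    have h3 : α * u - m * u ^ 2 ≤ α ^ 2 / (4 * m) := by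
      rw [le_div_iff₀ (by positivity)]
      nlinarith [sq_nonneg (2 * m * u - α)]
    linarith
  · refine main (Real.log 2 - α * l / 2) (2 * l) α (Real.log 2 ^ 2 / l - α * Real.log 2) ?_ hg
      fun L => ?_
    · rw [lt_div_iff₀ hl] at hα; linarith
    · have h2 : 2 * l * (l * L / 2 - Real.log 2) ^ 2 / (2 * l ^ 2) =
          l * (L : ℝ) ^ 2 / 4 - Real.log 2 * L + Real.log 2 ^ 2 / l := by
        field_simp; ring
      rw [h2]
      linarith

/-! ### Convergence of the interpolation series -/

/-- Completing the square: on the circle of radius `q^{-L/2} / 2` the growth of `f`, the size of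
`ρ_M(x)` and the size of `ρ_M` on the circle nearly cancel. -/
theorem rpow_completion {q : ℝ} (hq : 0 < q) (L M : ℕ) :
    q ^ (-((L : ℝ) ^ 2 / 4)) * q ^ (-((M : ℝ) ^ 2 / 4)) * ((q ^ (-(L : ℝ) / 2)) ^ M)⁻¹ =
      q ^ (-(((L : ℝ) - M) ^ 2 / 4)) := by
  rw [← Real.rpow_natCast (q ^ _), ← Real.rpow_mul hq.le, ← Real.rpow_neg hq.le, ← Real.rpow_add hq,
    ← Real.rpow_add hq]
  congr 1; ring

theorem radius_sq_mul {q : ℝ} (hq : 0 < q) (L : ℕ) : (q ^ (-(L : ℝ) / 2)) ^ 2 * q ^ L = 1 := by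
  rw [← Real.rpow_natCast, ← Real.rpow_natCast, ← Real.rpow_mul hq.le, ← Real.rpow_add hq]
  have : -(L : ℝ) / 2 * (2 : ℕ) + L = 0 := by push_cast; ring
  rw [this, Real.rpow_zero]

theorem norm_contourCoef_le {q : ℝ} {f : ℂ → ℂ} {T c B : ℝ} (hT : 0 < T) (hc : 0 < c) (k : ℕ)
    (hB : ∀ s : ℂ, ‖s‖ = T / 2 → ‖f s‖ ≤ B)
    (hr : ∀ s : ℂ, ‖s‖ = T / 2 → c * T ^ (k + 2) ≤ ‖rho q (k + 2) s‖) :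
    ‖contourCoef q f (T / 2) k‖ ≤ B / c * (T ^ k)⁻¹ := by
  have h : ∀ s ∈ Metric.sphere (0 : ℂ) (T / 2),
      ‖4 * s / rho q (k + 2) s * f s‖ ≤ 4 * (T / 2) / (c * T ^ (k + 2)) * B := by
    intro s hs
    have hs' : ‖s‖ = T / 2 := by simpa using hs
    rw [norm_mul, norm_div, norm_mul, hs', show ‖(4 : ℂ)‖ = 4 by simp]
    exact mul_le_mul (div_le_div_of_nonneg_left (by positivity) (by positivity) (hr s hs'))
      (hB s hs') (norm_nonneg _) (by positivity)
  refine (circleIntegral.norm_two_pi_i_inv_smul_integral_le_of_norm_le_const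
    (by positivity) h).trans_eq ?_
  field_simp
  ring

theorem norm_contourRem_le {q : ℝ} {f : ℂ → ℂ} {T c B : ℝ} (hT : 0 < T) (hc : 0 < c) (M : ℕ)
    (hB : ∀ s : ℂ, ‖s‖ = T / 2 → ‖f s‖ ≤ B)
    (hr : ∀ s : ℂ, ‖s‖ = T / 2 → c * T ^ M ≤ ‖rho q M s‖) {x : ℂ} (hx : ‖x‖ ^ 2 ≤ T ^ 2 / 8) :
    ‖contourRem q f (T / 2) M x‖ ≤ 2 * (B / c) * (T ^ M)⁻¹ := by
  have h : ∀ s ∈ Metric.sphere (0 : ℂ) (T / 2),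
      ‖s / ((s ^ 2 - x ^ 2) * rho q M s) * f s‖ ≤ T / 2 / (T ^ 2 / 8 * (c * T ^ M)) * B := by
    intro s hs
    have hs' : ‖s‖ = T / 2 := by simpa using hs
    have h1 : T ^ 2 / 8 ≤ ‖s ^ 2 - x ^ 2‖ := by
      have := norm_sub_norm_le (s ^ 2) (x ^ 2)
      rw [norm_pow, norm_pow, hs', div_pow] at this
      linarith
    rw [norm_mul, norm_div, norm_mul, hs']
    exact mul_le_mul (div_le_div_of_nonneg_left (by positivity) (by positivity)
      (mul_le_mul h1 (hr s hs') (by positivity) (norm_nonneg _)))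
      (hB s hs') (norm_nonneg _) (by positivity)
  refine (circleIntegral.norm_two_pi_i_inv_smul_integral_le_of_norm_le_const
    (by positivity) h).trans_eq ?_
  field_simp
  ring

/-- The `q`-Taylor expansion at the node `0`, in normalized form. -/
theorem hasSum_awCoef_mul_eCoef {q : ℝ} (hq : 0 < q) (hq1 : q < 1) {f : ℂ → ℂ}
    (hf : Differentiable ℂ f)
    (hgrowth : (∃ k α : ℝ, k < 2 * Real.log q⁻¹ ∧ QExpGrowth q f k α) ∨
      (∃ α : ℝ, α < 2 * Real.log 2 / Real.log q⁻¹ ∧ QExpGrowth q f (2 * Real.log q⁻¹) α)) (x : ℂ) :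
    HasSum (fun k => awCoef q f k * eCoef q k x) (f x) := by
  obtain ⟨K, r, hK, hr0, hr1, hfb⟩ := exists_norm_le_on_circles hq hq1 hgrowth
  obtain ⟨c, hc, hlow⟩ := exists_mul_pow_le_norm_rho hq hq1
  obtain ⟨C, hC, hup⟩ := exists_norm_rho_le hq hq1 x
  have hTpos : ∀ L : ℕ, 0 < q ^ (-(L : ℝ) / 2) := fun L => Real.rpow_pos_of_pos hq _
  have hne : ∀ L : ℕ, ∀ s : ℂ, ‖s‖ = q ^ (-(L : ℝ) / 2) / 2 → ∀ n ≤ L, rho q n s ≠ 0 := by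
    intro L s hs n hn
    rw [← norm_pos_iff]
    exact (mul_pos hc (pow_pos (hTpos L) n)).trans_le
      (hlow L _ (hTpos L) (radius_sq_mul hq L) s hs n hn)
  have hexp : ∀ e : ℝ, e ^ 2 ≤ 4 → q ^ (-(e ^ 2 / 4)) ≤ q ^ (-1 : ℝ) := fun e he =>
    Real.rpow_le_rpow_of_exponent_ge hq hq1.le (by linarith)
  set A := K * C / c * q ^ (-1 : ℝ) with hA
  have hA0 : 0 < A := mul_pos (by positivity) (Real.rpow_pos_of_pos hq _)
  -- the common estimate for terms and remainders, with `M = L - 1` or `M = L - 2`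
  have hcomb : ∀ L M : ℕ, ((L : ℝ) - M) ^ 2 ≤ 4 →
      (K * r ^ L * q ^ (-((L : ℝ) ^ 2 / 4))) / c * ((q ^ (-(L : ℝ) / 2)) ^ M)⁻¹ *
        (C * q ^ (-((M : ℝ) ^ 2 / 4))) ≤ A * r ^ L := by
    intro L M hLM
    have h1 := rpow_completion hq L M
    calc _ = K * C / c * r ^ L * (q ^ (-((L : ℝ) ^ 2 / 4)) * q ^ (-((M : ℝ) ^ 2 / 4)) *
          ((q ^ (-(L : ℝ) / 2)) ^ M)⁻¹) := by ring
      _ ≤ K * C / c * r ^ L * q ^ (-1 : ℝ) := by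
          rw [h1]; exact mul_le_mul_of_nonneg_left (hexp _ hLM) (by positivity)
      _ = A * r ^ L := by rw [hA]; ring
  have hterm : ∀ k, ‖awCoef q f k * eCoef q k x‖ ≤ A * r ^ 2 * r ^ k := by
    intro k
    rw [← contourCoef_mul_rho hq hq1 hf (hTpos (k + 2)) (radius_sq_mul hq (k + 2))
      (by omega : k + 1 ≤ k + 2) (hne (k + 2)) (by omega), norm_mul]
    refine (mul_le_mul (norm_contourCoef_le (hTpos (k + 2)) hc k (hfb (k + 2)) fun s hs =>
      hlow _ _ (hTpos (k + 2)) (radius_sq_mul hq (k + 2)) s hs _ le_rfl) (hup k) (norm_nonneg _)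
      ?_).trans ((hcomb (k + 2) k (by push_cast; ring_nf; norm_num)).trans_eq (by ring))
    have := hTpos (k + 2)
    have := Real.rpow_pos_of_pos hq (-(((k + 2 : ℕ) : ℝ) ^ 2 / 4))
    positivity
  have hsum : Summable fun k => ‖awCoef q f k * eCoef q k x‖ :=
    Summable.of_nonneg_of_le (fun _ => norm_nonneg _) hterm
      ((summable_geometric_of_lt_one hr0.le hr1).mul_left _)
  rw [hasSum_iff_tendsto_nat_of_summable_norm hsum, tendsto_iff_norm_sub_tendsto_zero]
  have hlarge : ∀ᶠ N : ℕ in atTop, 16 * ‖x‖ ^ 2 * q ^ (N + 2) < 1 := by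
    have h1 := (tendsto_add_atTop_iff_nat 2).2 (tendsto_pow_atTop_nhds_zero_of_lt_one hq.le hq1)
    have h2 := h1.const_mul (16 * ‖x‖ ^ 2)
    rw [mul_zero] at h2
    exact h2.eventually (gt_mem_nhds one_pos)
  refine squeeze_zero' (Eventually.of_forall fun _ => norm_nonneg _)
    (g := fun N => 4 * A * r ^ 2 * r ^ N) ?_ ?_
  · filter_upwards [hlarge] with N hN
    have hT := hTpos (N + 2)
    have hTL := radius_sq_mul hq (N + 2)
    have hx2 : ‖x‖ ^ 2 ≤ (q ^ (-((N + 2 : ℕ) : ℝ) / 2)) ^ 2 / 16 := by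
      rw [le_div_iff₀ (by norm_num)]
      by_contra hcon
      have := mul_lt_mul_of_pos_right (not_le.1 hcon) (pow_pos hq (N + 2))
      rw [hTL] at this
      linarith
    have hxT : ‖x‖ < q ^ (-((N + 2 : ℕ) : ℝ) / 2) / 2 := by
      refine lt_of_pow_lt_pow_left₀ 2 (by positivity) ?_
      rw [div_pow]
      have : 0 < (q ^ (-((N + 2 : ℕ) : ℝ) / 2)) ^ 2 := by positivity
      linarith
    have hint := interpolation_formula hq hf (by positivity) N
      (fun s hs n hn => hne (N + 2) s hs n (by omega)) hxT
    rw [Finset.sum_congr rfl fun k hk => contourCoef_mul_rho hq hq1 hf hT hTL (by omega : N ≤ N + 2)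
      (fun s hs n hn => hne (N + 2) s hs n (by omega)) (Finset.mem_range.1 hk) x] at hint
    have hrem : ∀ M, N ≤ M → M ≤ N + 1 →
        ‖rho q M x * contourRem q f (q ^ (-((N + 2 : ℕ) : ℝ) / 2) / 2) M x‖ ≤
          2 * (A * r ^ (N + 2)) := by
      intro M h1 h2
      have h3 := norm_contourRem_le hT hc M (hfb (N + 2)) (fun s hs =>
        hlow _ _ hT hTL s hs M (by omega)) (x := x) (hx2.trans (by
          have : 0 < (q ^ (-((N + 2 : ℕ) : ℝ) / 2)) ^ 2 := by positivity
          linarith))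
      have hLM : (((N + 2 : ℕ) : ℝ) - M) ^ 2 ≤ 4 := by
        have h4 : (N : ℝ) ≤ M := by exact_mod_cast h1
        have h5 : (M : ℝ) ≤ N + 1 := by exact_mod_cast h2
        push_cast
        nlinarith
      rw [norm_mul, mul_comm]
      refine (mul_le_mul h3 (hup M) (norm_nonneg _) ((norm_nonneg _).trans h3)).trans ?_
      have := hcomb (N + 2) M hLM
      linarith
    rw [hint, sub_add_cancel_left, norm_neg]
    refine (norm_add_le _ _).trans ((add_le_add (hrem N le_rfl (by omega))
      (hrem (N + 1) (by omega) le_rfl)).trans_eq (by ring))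
  · have := (tendsto_pow_atTop_nhds_zero_of_lt_one hr0.le hr1).const_mul (4 * A * r ^ 2)
    rwa [mul_zero] at this

/-- The normalization `γ (1 - q) / 2 = q^{1/4}` accounts for the factor `q^{-k/4}`. -/
theorem rho_term_eq {q : ℝ} (hq : 0 < q) (hq1 : q < 1) (f : ℂ → ℂ) (k : ℕ) (x : ℂ) :
    rp q (((k : ℝ) ^ 2 - k) / 4) * (1 - (q : ℂ)) ^ k / (2 ^ k * qPoch q q k) *
      ((awD q)^[k] f 0) * rho q k x = awCoef q f k * eCoef q k x := by
  have e : rp q ((k : ℝ) ^ 2 / 4) = rp q (((k : ℝ) ^ 2 - k) / 4) * rp q (1 / 4) ^ k := by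
    rw [show rp q (1 / 4) ^ k = rp q (k / 4) by
      unfold rp; rw [← Complex.ofReal_pow, ← Real.rpow_natCast, ← Real.rpow_mul hq.le]
      congr 2; ring]
    rw [← rp_add hq]; congr 1; ring
  have h1 : (1 - (q : ℂ)) ≠ 0 := by
    simpa using one_sub_pow_ne_zero (norm_q_lt_one hq hq1) 0
  have h2 := rp_ne_zero hq (1 / 4)
  have h3 := qPoch_self_ne_zero (norm_q_lt_one hq hq1) k
  have h4 : (1 - (q : ℂ)) ^ k ≠ 0 := pow_ne_zero _ h1
  have h5 : rp q (1 / 4) ^ k ≠ 0 := pow_ne_zero _ h2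
  unfold awCoef eCoef gam
  rw [e, div_pow, mul_pow]
  field_simp

/-! ### Infinite `q`-shifted factorials and the `q`-binomial theorem -/

theorem summable_norm_mul_pow {p : ℂ} (hp : ‖p‖ < 1) (a : ℂ) :
    Summable fun k : ℕ => ‖-(a * p ^ k)‖ := by
  simp only [norm_neg, norm_mul, norm_pow]
  exact (summable_geometric_of_lt_one (norm_nonneg _) hp).mul_left _

theorem multipliable_qPochInf {p : ℂ} (hp : ‖p‖ < 1) (a : ℂ) :
    Multipliable fun k : ℕ => 1 - a * p ^ k := by
  simpa [sub_eq_add_neg] using multipliable_one_add_of_summable (summable_norm_mul_pow hp a)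

theorem tendsto_qPoch {p : ℂ} (hp : ‖p‖ < 1) (a : ℂ) :
    Tendsto (qPoch a p) atTop (𝓝 (qPochInf a p)) :=
  (multipliable_qPochInf hp a).hasProd.tendsto_prod_nat

theorem qPochInf_ne_zero {p : ℂ} (hp : ‖p‖ < 1) {a : ℂ} (h : ∀ k : ℕ, 1 - a * p ^ k ≠ 0) :
    qPochInf a p ≠ 0 := by
  have := tprod_one_add_ne_zero_of_summable (f := fun k : ℕ => -(a * p ^ k))
    (fun k => by simpa [sub_eq_add_neg] using h k) (summable_norm_mul_pow hp a)
  simpa [qPochInf, sub_eq_add_neg] using this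

theorem qPochInf_ne_zero_of_norm_lt_one {p : ℂ} (hp : ‖p‖ < 1) {a : ℂ} (ha : ‖a‖ < 1) :
    qPochInf a p ≠ 0 := by
  refine qPochInf_ne_zero hp fun k h => ?_
  have h1 : ‖a * p ^ k‖ = 1 := by rw [← sub_eq_zero.1 h]; simp
  rw [norm_mul, norm_pow] at h1
  have h2 : ‖p‖ ^ k ≤ 1 := pow_le_one₀ (norm_nonneg _) hp.le
  nlinarith [norm_nonneg a]

theorem qPochInf_sq {p : ℂ} (hp : ‖p‖ < 1) (a : ℂ) :
    qPochInf (a ^ 2) (p ^ 2) = qPochInf a p * qPochInf (-a) p := by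
  unfold qPochInf
  rw [← (multipliable_qPochInf hp a).tprod_mul (multipliable_qPochInf hp (-a))]
  exact tprod_congr fun k => by ring

theorem qPochInf_split {p : ℂ} (hp : ‖p‖ < 1) (a : ℂ) :
    qPochInf a p = qPochInf a (p ^ 2) * qPochInf (a * p) (p ^ 2) := by
  have hp2 : ‖p ^ 2‖ < 1 := by
    rw [norm_pow]; exact pow_lt_one₀ (norm_nonneg _) hp two_ne_zero
  have h1 : ∀ k, 1 - a * p ^ (2 * k) = 1 - a * (p ^ 2) ^ k := fun k => by rw [pow_mul]
  have h2 : ∀ k, 1 - a * p ^ (2 * k + 1) = 1 - a * p * (p ^ 2) ^ k := fun k => by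
    rw [pow_succ, pow_mul]; ring
  unfold qPochInf
  rw [← tprod_even_mul_odd (f := fun k => 1 - a * p ^ k)
    (by simpa only [h1] using multipliable_qPochInf hp2 a)
    (by simpa only [h2] using multipliable_qPochInf hp2 (a * p))]
  simp only [h1, h2]

theorem qPochInf_step {p : ℂ} (hp : ‖p‖ < 1) (a : ℂ) :
    qPochInf a p = (1 - a) * qPochInf (a * p) p := by
  have h1 : Tendsto (fun n => qPoch a p (n + 1)) atTop (𝓝 (qPochInf a p)) :=
    (tendsto_add_atTop_iff_nat 1).2 (tendsto_qPoch hp a)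
  refine tendsto_nhds_unique h1 ?_
  refine ((tendsto_qPoch hp (a * p)).const_mul (1 - a)).congr fun n => ?_
  unfold qPoch
  rw [Finset.prod_range_succ', mul_comm, pow_zero, mul_one]
  congr 1
  exact Finset.prod_congr rfl fun k _ => by ring

theorem qBinomial_coef_bounded {p : ℂ} (hp : ‖p‖ < 1) (a : ℂ) :
    ∃ C : ℝ, ∀ n, ‖qPoch a p n / qPoch p p n‖ ≤ C := by
  have h := ((tendsto_qPoch hp a).div (tendsto_qPoch hp p)
    (qPochInf_ne_zero_of_norm_lt_one hp hp))
  obtain ⟨C, hC⟩ := (Metric.isBounded_range_of_tendsto _ h).exists_norm_le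
  exact ⟨C, fun n => hC _ ⟨n, rfl⟩⟩

/-- The `q`-binomial theorem `∑ (a; p)_n / (p; p)_n tⁿ = (at; p)_∞ / (t; p)_∞`, from the functional
equation `(1 - t) G(t) = (1 - at) G(pt)` of the left-hand side. -/
theorem hasSum_qBinomial {p : ℂ} (hp : ‖p‖ < 1) (a : ℂ) {t : ℂ} (ht : ‖t‖ < 1) :
    HasSum (fun n => qPoch a p n / qPoch p p n * t ^ n) (qPochInf (a * t) p / qPochInf t p) := by
  obtain ⟨C, hC⟩ := qBinomial_coef_bounded hp a
  set b : ℕ → ℂ := fun n => qPoch a p n / qPoch p p n with hb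
  have hb0 : b 0 = 1 := by simp [hb, qPoch]
  have hrec : ∀ n, (1 - p ^ (n + 1)) * b (n + 1) = (1 - a * p ^ n) * b n := fun n => by
    have h1 := one_sub_pow_ne_zero hp n
    have h2 := qPoch_self_ne_zero hp n
    simp only [hb, qPoch_succ]
    rw [← pow_succ']
    field_simp
  have hsum : ∀ s : ℂ, ‖s‖ < 1 → Summable fun n => b n * s ^ n := fun s hs => by
    refine Summable.of_norm_bounded ((summable_geometric_of_lt_one (norm_nonneg _) hs).mul_left C)
      fun n => ?_
    rw [norm_mul, norm_pow]
    exact mul_le_mul_of_nonneg_right (hC n) (by positivity)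
  set G : ℂ → ℂ := fun s => ∑' n, b n * s ^ n with hG
  have hGs : ∀ s : ℂ, ‖s‖ < 1 → HasSum (fun n => b n * s ^ n) (G s) := fun s hs => (hsum s hs).hasSum
  have hps : ∀ s : ℂ, ‖s‖ < 1 → ‖s * p‖ < 1 := fun s hs => by
    rw [norm_mul]; nlinarith [norm_nonneg s, norm_nonneg p]
  have hfun : ∀ s : ℂ, ‖s‖ < 1 → (1 - s) * G s = (1 - a * s) * G (s * p) := by
    intro s hs
    have h1 := hGs s hs
    have h2 := hGs (s * p) (hps s hs)
    have h3 := (hasSum_nat_add_iff' 1).2 h1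
    have h4 := (hasSum_nat_add_iff' 1).2 h2
    simp only [Finset.sum_range_one, hb0, pow_zero, mul_one] at h3 h4
    have h5 := h3.sub (h1.mul_left s)
    have h6 := h4.sub (h2.mul_left (a * s))
    have h7 := h5.unique (h6.congr_fun ?_)
    · linear_combination h7
    · intro n
      have := hrec n
      linear_combination (s ^ (n + 1)) * this
  have hiter : ∀ n : ℕ, qPoch t p n * G t = qPoch (a * t) p n * G (t * p ^ n) := by
    intro n
    induction n with
    | zero => simp [qPoch]
    | succ n ih =>
      have htn : ‖t * p ^ n‖ < 1 := by
        rw [norm_mul, norm_pow]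
        have h2 : ‖p‖ ^ n ≤ 1 := pow_le_one₀ (norm_nonneg _) hp.le
        nlinarith [norm_nonneg t]
      have := hfun _ htn
      rw [mul_assoc, ← pow_succ] at this
      rw [qPoch_succ, qPoch_succ]
      linear_combination (1 - t * p ^ n) * ih + qPoch (a * t) p n * this
  have hlim : Tendsto (fun n : ℕ => G (t * p ^ n)) atTop (𝓝 1) := by
    have h0 : (1 : ℂ) = ∑' m, b m * (0 : ℂ) ^ m := by
      rw [tsum_eq_single 0 (fun m hm => by simp [hm])]; simp [hb0]
    rw [h0]
    refine tendsto_tsum_of_dominated_convergence (bound := fun m => C * ‖t‖ ^ m)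
      ((summable_geometric_of_lt_one (norm_nonneg _) ht).mul_left C) (fun m => ?_)
      (Eventually.of_forall fun n m => ?_)
    · have := (tendsto_pow_atTop_nhds_zero_of_norm_lt_one hp).const_mul t
      rw [mul_zero] at this
      exact (this.pow m).const_mul _
    · rw [norm_mul, norm_pow, norm_mul, norm_pow]
      have h2 : ‖p‖ ^ n ≤ 1 := pow_le_one₀ (norm_nonneg _) hp.le
      exact mul_le_mul (hC m) (pow_le_pow_left₀ (by positivity)
        (mul_le_of_le_one_right (norm_nonneg _) h2) m) (by positivity)
        ((norm_nonneg _).trans (hC m))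
  have hfin : qPochInf t p * G t = qPochInf (a * t) p * 1 :=
    tendsto_nhds_unique ((tendsto_qPoch hp t).mul_const (G t))
      (((tendsto_qPoch hp (a * t)).mul hlim).congr fun n => (hiter n).symm)
  have : qPochInf (a * t) p / qPochInf t p = G t := by
    rw [div_eq_iff (qPochInf_ne_zero_of_norm_lt_one hp ht)]
    linear_combination -hfin
  rw [this]
  exact hGs t ht

/-! ### The power series of `w ↦ ℰ_q(x; w)` -/

/-- The coefficients of `(q w²; q²)_∞ / (w²; q²)_∞`. -/
def hCoef (q : ℝ) : ℕ → ℂ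
  | 0 => 1
  | 1 => 0
  | n + 2 => (1 - (q : ℂ) ^ (n + 1)) / (1 - (q : ℂ) ^ (n + 2)) * hCoef q n

/-- The coefficients of the series defining `ℰ_q(x; w)`, without the prefactor. -/
def cCoef (q : ℝ) (x : ℂ) : ℕ → ℂ
  | 0 => 1
  | 1 => rp q (1 / 4) * (2 * x) / (1 - q)
  | n + 2 => (4 * x ^ 2 * (q : ℂ) ^ (n + 1) + (1 - (q : ℂ) ^ (n + 1)) ^ 2) /
      ((1 - (q : ℂ) ^ (n + 1)) * (1 - (q : ℂ) ^ (n + 2))) * cCoef q x n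

theorem hCoef_odd (q : ℝ) (m : ℕ) : hCoef q (2 * m + 1) = 0 := by
  induction m with
  | zero => rfl
  | succ m ih => rw [show 2 * (m + 1) + 1 = (2 * m + 1) + 2 by ring, hCoef, ih, mul_zero]

theorem norm_q_sq_lt_one {q : ℝ} (hq : 0 < q) (hq1 : q < 1) : ‖(q : ℂ) ^ 2‖ < 1 := by
  rw [norm_pow]; exact pow_lt_one₀ (norm_nonneg _) (norm_q_lt_one hq hq1) two_ne_zero

theorem hCoef_even (q : ℝ) (m : ℕ) :
    hCoef q (2 * m) = qPoch q ((q : ℂ) ^ 2) m / qPoch ((q : ℂ) ^ 2) ((q : ℂ) ^ 2) m := by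
  induction m with
  | zero => simp [hCoef, qPoch]
  | succ m ih =>
    rw [show 2 * (m + 1) = (2 * m) + 2 by ring, hCoef, ih, qPoch_succ, qPoch_succ,
      show (q : ℂ) * ((q : ℂ) ^ 2) ^ m = q ^ (2 * m + 1) by rw [← pow_mul]; ring,
      show (q : ℂ) ^ 2 * ((q : ℂ) ^ 2) ^ m = q ^ (2 * m + 2) by rw [← pow_mul]; ring, div_mul_div_comm]
    congr 1 <;> ring

theorem hasSum_hCoef {q : ℝ} (hq : 0 < q) (hq1 : q < 1) {w : ℂ} (hw : ‖w‖ < 1) :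
    HasSum (fun n => hCoef q n * w ^ n)
      (qPochInf ((q : ℂ) * w ^ 2) ((q : ℂ) ^ 2) / qPochInf (w ^ 2) ((q : ℂ) ^ 2)) := by
  have hw2 : ‖w ^ 2‖ < 1 := by rw [norm_pow]; exact pow_lt_one₀ (norm_nonneg _) hw two_ne_zero
  have h1 := hasSum_qBinomial (norm_q_sq_lt_one hq hq1) q hw2
  have h2 : HasSum (fun k => hCoef q (2 * k) * w ^ (2 * k))
      (qPochInf ((q : ℂ) * w ^ 2) ((q : ℂ) ^ 2) / qPochInf (w ^ 2) ((q : ℂ) ^ 2)) := by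
    simp only [hCoef_even, pow_mul w]; exact h1
  have h3 : HasSum (fun k => hCoef q (2 * k + 1) * w ^ (2 * k + 1)) 0 := by
    simp only [hCoef_odd, zero_mul]; exact hasSum_zero
  have h4 := HasSum.even_add_odd (f := fun n => hCoef q n * w ^ n) h2 h3
  rwa [add_zero] at h4

theorem summable_norm_hCoef {q : ℝ} (hq : 0 < q) (hq1 : q < 1) {w : ℂ} (hw : ‖w‖ < 1) :
    Summable fun n => ‖hCoef q n * w ^ n‖ := (hasSum_hCoef hq hq1 hw).summable.norm

theorem summable_norm_eCoef {q : ℝ} (hq : 0 < q) (hq1 : q < 1) (x : ℂ) {w : ℂ} (hw : ‖w‖ < 1) :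
    Summable fun n => ‖eCoef q n x * w ^ n‖ := by
  obtain ⟨C, _, hC⟩ := exists_norm_eCoef_le hq hq1 x
  refine Summable.of_nonneg_of_le (fun _ => norm_nonneg _) (fun n => ?_)
    ((summable_geometric_of_lt_one (norm_nonneg _) hw).mul_left C)
  rw [norm_mul, norm_pow]
  exact mul_le_mul_of_nonneg_right (hC n) (by positivity)

open PowerSeries in
/-- Both sides have a generating function `F` with
`q(1 - w²)F(w) - (q + 1 + (4x² - 2)q²w²)F(qw) + (1 - q³w²)F(q²w) = 0`. -/
theorem cCoef_eq_sum_antidiagonal {q : ℝ} (hq : 0 < q) (hq1 : q < 1) (x : ℂ) (n : ℕ) :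
    cCoef q x n = ∑ ij ∈ Finset.HasAntidiagonal.antidiagonal n, eCoef q ij.1 x * hCoef q ij.2 := by
  have hn := norm_q_lt_one hq hq1
  set E : PowerSeries ℂ := PowerSeries.mk fun n => eCoef q n x with hE
  set H : PowerSeries ℂ := PowerSeries.mk (hCoef q) with hH
  have hX2 : ∀ (n : ℕ) (F : PowerSeries ℂ), coeff (n + 1 + 1) (X ^ 2 * F) = coeff n F :=
    fun n F => coeff_X_pow_mul F 2 n
  have hHrec : ∀ n, (1 - (q : ℂ) ^ (n + 2)) * hCoef q (n + 2) =
      (1 - (q : ℂ) ^ (n + 1)) * hCoef q n := fun n => by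
    have h2 := one_sub_pow_ne_zero hn (n + 1)
    rw [hCoef]; field_simp
  have hH1 : (1 - X ^ 2) * H = (1 - C (q : ℂ) * X ^ 2) * rescale (q : ℂ) H := by
    ext n
    simp only [sub_mul, map_sub, one_mul, mul_assoc, coeff_C_mul]
    rcases n with _ | _ | n
    · simp [coeff_X_pow_mul']
    · simp [coeff_X_pow_mul', hH, hCoef]
    · simp only [hX2, hH, coeff_mk, coeff_rescale]
      linear_combination hHrec n
  have hH2 : (1 - C ((q : ℂ) ^ 2) * X ^ 2) * rescale (q : ℂ) H =
      (1 - C ((q : ℂ) ^ 3) * X ^ 2) * rescale ((q : ℂ) ^ 2) H := by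
    ext n
    simp only [sub_mul, map_sub, one_mul, mul_assoc, coeff_C_mul]
    rcases n with _ | _ | n
    · simp [coeff_X_pow_mul']
    · simp [coeff_X_pow_mul', hH, hCoef]
    · simp only [hX2, hH, coeff_mk, coeff_rescale]
      linear_combination (q : ℂ) ^ (n + 2) * hHrec n
  have hE1 : C (q : ℂ) * (1 - C (q : ℂ) * X ^ 2) * E -
      (C ((q : ℂ) + 1) + C ((4 * x ^ 2 - 2) * (q : ℂ) ^ 2) * X ^ 2) * rescale (q : ℂ) E +
      (1 - C ((q : ℂ) ^ 2) * X ^ 2) * rescale ((q : ℂ) ^ 2) E = 0 := by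
    ext n
    simp only [sub_mul, add_mul, map_sub, map_add, one_mul, mul_sub, mul_one, mul_assoc,
      coeff_C_mul]
    rcases n with _ | _ | n
    · simp [coeff_X_pow_mul', hE]
    · simp [coeff_X_pow_mul', hE]
      ring
    · simp only [hX2, hE, coeff_mk, coeff_rescale, map_zero]
      linear_combination (q : ℂ) * eCoef_add_two hq hq1 n x
  have hU : C (q : ℂ) * (1 - X ^ 2) * (E * H) -
      (C ((q : ℂ) + 1) + C ((4 * x ^ 2 - 2) * (q : ℂ) ^ 2) * X ^ 2) * rescale (q : ℂ) (E * H) +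
      (1 - C ((q : ℂ) ^ 3) * X ^ 2) * rescale ((q : ℂ) ^ 2) (E * H) = 0 := by
    rw [map_mul (rescale (q : ℂ)), map_mul (rescale ((q : ℂ) ^ 2))]
    linear_combination C (q : ℂ) * E * hH1 - rescale ((q : ℂ) ^ 2) E * hH2 +
      rescale (q : ℂ) H * hE1
  have hrec : ∀ n, (1 - (q : ℂ) ^ (n + 1)) * (1 - (q : ℂ) ^ (n + 2)) * coeff (n + 2) (E * H) =
      (4 * x ^ 2 * (q : ℂ) ^ (n + 1) + (1 - (q : ℂ) ^ (n + 1)) ^ 2) * coeff n (E * H) := by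
    intro n
    have hqc : (q : ℂ) ≠ 0 := by exact_mod_cast hq.ne'
    have := congrArg (coeff (n + 2)) hU
    rw [← mul_right_inj' hqc]
    generalize E * H = U at *
    simp only [sub_mul, add_mul, map_sub, map_add, one_mul, mul_sub, mul_one, mul_assoc,
      coeff_C_mul, coeff_X_pow_mul, coeff_rescale] at this
    simp at this
    linear_combination this
  rw [← show coeff n (E * H) = ∑ ij ∈ Finset.HasAntidiagonal.antidiagonal n, eCoef q ij.1 x * hCoef q ij.2 by
    simp [coeff_mul, hE, hH]]
  induction n using Nat.twoStepInduction with
  | zero => simp [cCoef, coeff_mul, hE, hH, eCoef_zero, hCoef]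
  | one =>
    simp [cCoef, coeff_mul, hE, hH, eCoef_zero, eCoef_one, hCoef, Finset.Nat.antidiagonal_succ]
  | more n ih _ =>
    have h1 := one_sub_pow_ne_zero hn n
    have h2 := one_sub_pow_ne_zero hn (n + 1)
    rw [cCoef, ih, div_mul_eq_mul_div, ← hrec, div_eq_iff (mul_ne_zero h1 h2)]
    ring

/-! ### The `q`-exponential function -/

/-- The exponents `(1-n)/2, …, (n-1)/2` of `q` are symmetric, and passing from `n` to `n + 2` adds
the pair `±(n+1)/2`. -/
theorem qPoch_symm_add_two {q : ℝ} (hq : 0 < q) (z : ℂ) (n : ℕ) :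
    qPoch (-Complex.I * z * rp q ((1 - (n + 2 : ℕ)) / 2)) q (n + 2) =
      (1 + Complex.I * z * (rp q ((n + 1) / 2))⁻¹) * (1 + Complex.I * z * rp q ((n + 1) / 2)) *
        qPoch (-Complex.I * z * rp q ((1 - n) / 2)) q n := by
  have e1 : rp q ((1 - (n + 2 : ℕ)) / 2) = (rp q ((n + 1) / 2))⁻¹ := by
    rw [← rp_neg hq]; congr 1; push_cast; ring
  have e2 : rp q ((1 - n) / 2) = (rp q ((n + 1) / 2))⁻¹ * q := by
    rw [show (1 - (n : ℝ)) / 2 = -((n + 1) / 2) + 1 by ring, rp_add hq, rp_neg hq, rp_one]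
  have e3 : (q : ℂ) ^ (n + 1) = rp q ((n + 1) / 2) ^ 2 := by
    rw [sq, ← rp_add hq, ← rp_natCast]; congr 1; push_cast; ring
  have h0 := rp_ne_zero hq ((n + 1) / 2)
  unfold qPoch
  rw [Finset.prod_range_succ, Finset.prod_range_succ', e1, e2, e3]
  have : ∀ k, (1 - -Complex.I * z * (rp q ((n + 1) / 2))⁻¹ * (q : ℂ) ^ (k + 1)) =
      1 - -Complex.I * z * ((rp q ((n + 1) / 2))⁻¹ * q) * (q : ℂ) ^ k := fun k => by ring
  simp only [this, pow_zero, mul_one]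
  field_simp
  ring

theorem qExp_term_eq {q : ℝ} (hq : 0 < q) (hq1 : q < 1) (x w : ℂ) (n : ℕ) :
    (-Complex.I * w) ^ n / qPoch q q n * rp q ((n : ℝ) ^ 2 / 4) *
      (qPoch (-Complex.I * eith x * rp q ((1 - n) / 2)) q n *
        qPoch (-Complex.I * (eith x)⁻¹ * rp q ((1 - n) / 2)) q n) = cCoef q x n * w ^ n := by
  have hz := eith_ne_zero x
  have hx := jouk_eith x
  have hn := norm_q_lt_one hq hq1
  have hI : Complex.I ^ 2 = -1 := Complex.I_sq
  induction n using Nat.twoStepInduction with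
  | zero => simp [qPoch, cCoef, rp_zero]
  | one =>
    have h1 : (1 : ℂ) - q ≠ 0 := by simpa using one_sub_pow_ne_zero hn 0
    simp only [qPoch, Finset.prod_range_one, cCoef, pow_zero, pow_one, mul_one, Nat.cast_one,
      sub_self, zero_div, rp_zero, one_pow]
    conv_rhs => rw [← hx]
    generalize eith x = z at *
    unfold jouk
    field_simp
    linear_combination (-w * rp q (1 / 4) * (z ^ 2 + 1 + Complex.I * z)) * hI
  | more n ih _ =>
    have h1 := one_sub_pow_ne_zero hn n
    have h2 := one_sub_pow_ne_zero hn (n + 1)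
    have h3 := qPoch_self_ne_zero hn n
    have e : rp q (((n + 2 : ℕ) : ℝ) ^ 2 / 4) = rp q ((n : ℝ) ^ 2 / 4) * q ^ (n + 1) := by
      rw [← rp_natCast, ← rp_add hq]; congr 1; push_cast; ring
    have e3 : (q : ℂ) ^ (n + 1) = rp q ((n + 1) / 2) ^ 2 := by
      rw [sq, ← rp_add hq, ← rp_natCast]; congr 1; push_cast; ring
    have h4x : 4 * x ^ 2 = eith x ^ 2 + 2 + ((eith x)⁻¹) ^ 2 := by
      rw [← four_jouk_sq hz, hx]
    have h0 := rp_ne_zero hq ((n + 1) / 2)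
    rw [qPoch_symm_add_two hq, qPoch_symm_add_two hq, e, qPoch_succ, qPoch_succ, ← pow_succ',
      ← pow_succ', cCoef, pow_add w, pow_add (-Complex.I * w)]
    have key : (-Complex.I * w) ^ 2 * (q : ℂ) ^ (n + 1) *
        ((1 + Complex.I * eith x * (rp q ((n + 1) / 2))⁻¹) *
          (1 + Complex.I * eith x * rp q ((n + 1) / 2)) *
        ((1 + Complex.I * (eith x)⁻¹ * (rp q ((n + 1) / 2))⁻¹) *
          (1 + Complex.I * (eith x)⁻¹ * rp q ((n + 1) / 2)))) =
        w ^ 2 * (4 * x ^ 2 * (q : ℂ) ^ (n + 1) + (1 - (q : ℂ) ^ (n + 1)) ^ 2) := by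
      rw [h4x, e3]
      have hI3 : Complex.I ^ 3 = -Complex.I := by rw [pow_succ, hI]; ring
      have hI4 : Complex.I ^ 4 = 1 := Complex.I_pow_four
      have hI5 : Complex.I ^ 5 = Complex.I := by rw [pow_succ, hI4]; ring
      have hI6 : Complex.I ^ 6 = -1 := by rw [pow_succ, hI5, ← sq, hI]
      generalize eith x = z at *
      generalize rp q ((n + 1) / 2) = s at *
      field_simp
      ring_nf
      simp only [hI, hI3, hI4, hI5, hI6]
      ring
    calc _ = ((-Complex.I * w) ^ 2 * (q : ℂ) ^ (n + 1) *
        ((1 + Complex.I * eith x * (rp q ((n + 1) / 2))⁻¹) *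
          (1 + Complex.I * eith x * rp q ((n + 1) / 2)) *
        ((1 + Complex.I * (eith x)⁻¹ * (rp q ((n + 1) / 2))⁻¹) *
          (1 + Complex.I * (eith x)⁻¹ * rp q ((n + 1) / 2))))) /
          ((1 - (q : ℂ) ^ (n + 1)) * (1 - (q : ℂ) ^ (n + 2))) *
          ((-Complex.I * w) ^ n / qPoch q q n * rp q ((n : ℝ) ^ 2 / 4) *
      (qPoch (-Complex.I * eith x * rp q ((1 - n) / 2)) q n *
        qPoch (-Complex.I * (eith x)⁻¹ * rp q ((1 - n) / 2)) q n)) := by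
          generalize 1 - (q : ℂ) ^ (n + 1) = u
          generalize 1 - (q : ℂ) ^ (n + 2) = v
          generalize 1 + Complex.I * eith x * (rp q ((n + 1) / 2))⁻¹ = a
          generalize 1 + Complex.I * eith x * rp q ((n + 1) / 2) = b
          generalize 1 + Complex.I * (eith x)⁻¹ * (rp q ((n + 1) / 2))⁻¹ = c
          generalize 1 + Complex.I * (eith x)⁻¹ * rp q ((n + 1) / 2) = d
          ring
      _ = _ := by
          rw [key, ih]
          generalize 1 - (q : ℂ) ^ (n + 1) = u
          generalize 1 - (q : ℂ) ^ (n + 2) = v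
          ring

theorem norm_sq_lt_one {w : ℂ} (hw : ‖w‖ < 1) : ‖w ^ 2‖ < 1 := by
  rw [norm_pow]; exact pow_lt_one₀ (norm_nonneg _) hw two_ne_zero

theorem norm_q_mul_sq_lt_one {q : ℝ} (hq : 0 < q) (hq1 : q < 1) {w : ℂ} (hw : ‖w‖ < 1) :
    ‖(q : ℂ) * w ^ 2‖ < 1 := by
  rw [norm_mul]
  have h1 := norm_q_lt_one hq hq1
  have h2 := norm_sq_lt_one hw
  nlinarith [norm_nonneg (q : ℂ), norm_nonneg (w ^ 2)]

theorem hasSum_cCoef {q : ℝ} (hq : 0 < q) (hq1 : q < 1) (x : ℂ) {w : ℂ} (hw : ‖w‖ < 1) :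
    HasSum (fun n => cCoef q x n * w ^ n) ((∑' n, eCoef q n x * w ^ n) *
      (qPochInf ((q : ℂ) * w ^ 2) ((q : ℂ) ^ 2) / qPochInf (w ^ 2) ((q : ℂ) ^ 2))) := by
  have hE := summable_norm_eCoef hq hq1 x hw
  have hH := summable_norm_hCoef hq hq1 hw
  have h1 := summable_norm_sum_mul_antidiagonal_of_summable_norm hE hH
  have h2 := tsum_mul_tsum_eq_tsum_sum_antidiagonal_of_summable_norm hE hH
  rw [(hasSum_hCoef hq hq1 hw).tsum_eq] at h2
  rw [h2]
  refine h1.of_norm.hasSum.congr_fun fun n => ?_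
  rw [cCoef_eq_sum_antidiagonal hq hq1, Finset.sum_mul]
  refine Finset.sum_congr rfl fun ij hij => ?_
  rw [← Finset.HasAntidiagonal.mem_antidiagonal.1 hij, pow_add]
  ring

/-- The `q`-exponential function is the generating function of the polynomials `eCoef`. -/
theorem hasSum_qExp {q : ℝ} (hq : 0 < q) (hq1 : q < 1) (x : ℂ) {w : ℂ} (hw : ‖w‖ < 1) :
    HasSum (fun n => eCoef q n x * w ^ n) (qExp q x w) := by
  have hq2 := norm_q_sq_lt_one hq hq1
  have h1 := qPochInf_ne_zero_of_norm_lt_one hq2 (norm_sq_lt_one hw)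
  have h2 := qPochInf_ne_zero_of_norm_lt_one hq2 (norm_q_mul_sq_lt_one hq hq1 hw)
  have : qExp q x w = ∑' n, eCoef q n x * w ^ n := by
    unfold qExp
    simp only [qExp_term_eq hq hq1]
    rw [(hasSum_cCoef hq hq1 x hw).tsum_eq]
    generalize qPochInf ((q : ℂ) * w ^ 2) ((q : ℂ) ^ 2) = A at *
    field_simp
  rw [this]
  exact (summable_norm_eCoef hq hq1 x hw).of_norm.hasSum

theorem norm_rp_half_lt_one {q : ℝ} (hq : 0 < q) (hq1 : q < 1) : ‖rp q (1 / 2)‖ < 1 := by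
  rw [norm_rp hq]; exact Real.rpow_lt_one hq.le hq1 (by norm_num)

theorem eta_eq_jouk {q : ℝ} (hq : 0 < q) : eta q = jouk (rp q (1 / 4)) := by
  unfold eta jouk; rw [← rp_neg hq]; norm_num

theorem cCoef_eta {q : ℝ} (hq : 0 < q) (hq1 : q < 1) (n : ℕ) :
    cCoef q (eta q) n = qPoch (-rp q (1 / 2)) q n / qPoch q q n := by
  have hn := norm_q_lt_one hq hq1
  have hP := rp_half_sq hq
  have hr : rp q (1 / 4) ^ 2 = rp q (1 / 2) := by rw [sq, ← rp_add hq]; norm_num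
  have hr0 := rp_ne_zero hq (1 / 4)
  have hP0 := rp_ne_zero hq (1 / 2)
  rw [eta_eq_jouk hq]
  induction n using Nat.twoStepInduction with
  | zero => simp [cCoef, qPoch]
  | one =>
    have h1 : (1 : ℂ) - q ≠ 0 := by simpa using one_sub_pow_ne_zero hn 0
    simp only [qPoch, Finset.prod_range_one, cCoef, pow_zero, mul_one]
    unfold jouk
    field_simp
    linear_combination hr
  | more n ih _ =>
    have h1 := one_sub_pow_ne_zero hn n
    have h2 := one_sub_pow_ne_zero hn (n + 1)
    have h3 := qPoch_self_ne_zero hn n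
    rw [cCoef, ih, qPoch_succ, qPoch_succ, qPoch_succ, qPoch_succ, ← pow_succ', ← pow_succ',
      four_jouk_sq hr0, inv_pow, hr, div_mul_div_comm]
    congr 1
    · generalize qPoch (-rp q (1 / 2)) (q : ℂ) n = Q
      rw [pow_succ, ← hP]
      generalize rp q (1 / 2) = P at *
      field_simp
      ring
    · ring

/-- At `x = η` the `q`-exponential function is an infinite product. -/
theorem qExp_eta {q : ℝ} (hq : 0 < q) (hq1 : q < 1) {w : ℂ} (hw : ‖w‖ < 1) :
    qExp q (eta q) w =
      qPochInf (-w) (rp q (1 / 2)) / qPochInf ((q : ℂ) * w ^ 2) ((q : ℂ) ^ 2) := by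
  have hn := norm_q_lt_one hq hq1
  have h1 := qPochInf_ne_zero_of_norm_lt_one (norm_q_sq_lt_one hq hq1)
    (norm_q_mul_sq_lt_one hq hq1 hw)
  have h2 := qPochInf_ne_zero_of_norm_lt_one hn hw
  have h4 := hasSum_qBinomial hn (-rp q (1 / 2)) hw
  have h5 := qPochInf_split (norm_rp_half_lt_one hq hq1) (-w)
  rw [rp_half_sq hq] at h5
  unfold qExp
  simp only [qExp_term_eq hq hq1, cCoef_eta hq hq1]
  rw [h4.tsum_eq, qPochInf_sq hn, h5, neg_mul, neg_mul, mul_comm (rp q (1 / 2))]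
  field_simp

/-! ### Zeros of the basic sine function -/

/-- For `Im v > 0` each factor `1 + iv p^k` of `(-iv; p)_∞` is strictly smaller in norm than the
factor `1 - iv p^k` of `(iv; p)_∞`, so the two products differ. -/
theorem norm_qPochInf_I_mul_ne {p : ℝ} (hp0 : 0 < p) (hp1 : p < 1) {v : ℂ} (hv : 0 < v.im) :
    ‖qPochInf (Complex.I * v) p‖ ≠ ‖qPochInf (-(Complex.I * v)) p‖ := by
  have hp : ‖(p : ℂ)‖ < 1 := norm_q_lt_one hp0 hp1
  have hfac : ∀ k : ℕ, ‖1 - -(Complex.I * v) * (p : ℂ) ^ k‖ < ‖1 - Complex.I * v * (p : ℂ) ^ k‖ := by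
    intro k
    have hpk : 0 < p ^ k := pow_pos hp0 k
    refine lt_of_pow_lt_pow_left₀ 2 (norm_nonneg _) ?_
    rw [← Complex.normSq_eq_norm_sq, ← Complex.normSq_eq_norm_sq, Complex.normSq_apply,
      Complex.normSq_apply, ← Complex.ofReal_pow]
    generalize p ^ k = r at *
    simp
    nlinarith [mul_pos hv hpk]
  have hlim : ∀ a : ℂ, Tendsto (fun n => ‖qPoch a p n‖) atTop (𝓝 ‖qPochInf a p‖) := fun a =>
    (tendsto_qPoch hp a).norm
  have hne : ∀ k : ℕ, 1 - Complex.I * v * (p : ℂ) ^ k ≠ 0 := fun k =>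
    norm_pos_iff.1 ((norm_nonneg _).trans_lt (hfac k))
  have hstep1 := qPochInf_step hp (Complex.I * v)
  have hstep2 := qPochInf_step hp (-(Complex.I * v))
  have htail : ‖qPochInf (-(Complex.I * v) * p) p‖ ≤ ‖qPochInf (Complex.I * v * p) p‖ := by
    refine le_of_tendsto_of_tendsto' (hlim _) (hlim _) fun n => ?_
    unfold qPoch
    rw [norm_prod, norm_prod]
    refine Finset.prod_le_prod (fun i _ => norm_nonneg _) fun i _ => ?_
    have := hfac (i + 1)
    rw [pow_succ', ← mul_assoc, ← mul_assoc] at this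
    exact this.le
  have htne : qPochInf (Complex.I * v * p) p ≠ 0 := qPochInf_ne_zero hp fun k => by
    have := hne (k + 1)
    rwa [pow_succ', ← mul_assoc] at this
  rw [hstep1, hstep2, norm_mul, norm_mul]
  have h0 := hfac 0
  rw [pow_zero, mul_one, mul_one] at h0
  have h1 := norm_pos_iff.2 htne
  have h2 := norm_nonneg (1 - -(Complex.I * v))
  refine ne_of_gt ?_
  calc _ ≤ ‖1 - -(Complex.I * v)‖ * ‖qPochInf (Complex.I * v * p) p‖ :=
        mul_le_mul_of_nonneg_left htail h2
    _ < _ := mul_lt_mul_of_pos_right h0 h1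

/-- The denominator of the generating functions of the `q`-Bernoulli polynomials has no zero
`w ≠ 0` in the disc of radius `min 1 w₁`, because the zeros of the basic sine function are real. -/
theorem qExp_eta_sub_ne_zero {q : ℝ} (hq : 0 < q) (hq1 : q < 1) {w₁ : ℝ}
    (hw₁ : IsLeast {w : ℝ | 0 < w ∧ sinEta q w = 0} w₁) {w : ℂ} (hw0 : w ≠ 0) (hw1 : ‖w‖ < 1)
    (hww : ‖w‖ < w₁) : qExp q (eta q) w - qExp q (eta q) (-w) ≠ 0 := by
  intro h
  have h1 := qPochInf_ne_zero_of_norm_lt_one (norm_q_sq_lt_one hq hq1)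
    (norm_q_mul_sq_lt_one hq hq1 hw1)
  rw [qExp_eta hq hq1 hw1, qExp_eta hq hq1 (by rwa [norm_neg]), neg_sq, neg_neg,
    ← sub_div, div_eq_zero_iff, or_iff_left h1, sub_eq_zero] at h
  have hP0 : 0 < q ^ (1 / 2 : ℝ) := Real.rpow_pos_of_pos hq _
  have hP1 : q ^ (1 / 2 : ℝ) < 1 := Real.rpow_lt_one hq.le hq1 (by norm_num)
  obtain ⟨v, rfl⟩ : ∃ v, w = Complex.I * v := ⟨-Complex.I * w, by
    rw [← mul_assoc, mul_neg, Complex.I_mul_I]; ring⟩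
  have hnv : ‖Complex.I * v‖ = ‖v‖ := by simp
  rcases lt_trichotomy v.im 0 with him | him | him
  · have := norm_qPochInf_I_mul_ne hP0 hP1 (v := -v) (by simpa using him)
    rw [mul_neg, neg_neg] at this
    exact this (congrArg norm h)
  · have hv : v = (v.re : ℂ) := Complex.ext (by simp) (by simp [him])
    set t := v.re
    rw [hv] at h hw0 hww hnv
    have key : ∀ u : ℝ, 0 < u → qPochInf (-(Complex.I * u)) (rp q (1 / 2)) =
        qPochInf (Complex.I * u) (rp q (1 / 2)) → ‖(u : ℂ)‖ < w₁ → False := by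
      intro u hu hu2 hu3
      have : sinEta q u = 0 := by
        unfold sinEta
        rw [neg_mul, hu2, sub_self, zero_div]
      have h2 := hw₁.2 ⟨hu, this⟩
      rw [Complex.norm_real, Real.norm_of_nonneg hu.le] at hu3
      linarith
    rw [hnv] at hww
    rcases lt_trichotomy t 0 with ht | ht | ht
    · refine key (-t) (by linarith) ?_ ?_
      · push_cast
        rw [mul_neg, neg_neg]
        exact h.symm
      · push_cast
        rwa [norm_neg]
    · rw [ht] at hw0; simp at hw0
    · exact key t ht h hww
  · exact norm_qPochInf_I_mul_ne hP0 hP1 him (congrArg norm h).symm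

/-! ### Power series in the variable of the generating functions -/

open PowerSeries in
theorem hasSum_coeff_mul {a b : PowerSeries ℂ} {w A B : ℂ}
    (ha : HasSum (fun n => coeff n a * w ^ n) A) (hb : HasSum (fun n => coeff n b * w ^ n) B) :
    HasSum (fun n => coeff n (a * b) * w ^ n) (A * B) := by
  have h1 := summable_norm_sum_mul_antidiagonal_of_summable_norm ha.summable.norm hb.summable.norm
  have h2 := tsum_mul_tsum_eq_tsum_sum_antidiagonal_of_summable_norm ha.summable.norm
    hb.summable.norm
  rw [ha.tsum_eq, hb.tsum_eq] at h2
  rw [h2]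
  refine h1.of_norm.hasSum.congr_fun fun n => ?_
  rw [coeff_mul, Finset.sum_mul]
  refine Finset.sum_congr rfl fun ij hij => ?_
  rw [← Finset.HasAntidiagonal.mem_antidiagonal.1 hij, pow_add]
  ring

theorem eventually_punctured_of_norm_lt {R : ℝ} (hR : 0 < R) {p : ℂ → Prop}
    (h : ∀ w, w ≠ 0 → ‖w‖ < R → p w) : ∀ᶠ w in 𝓝[≠] (0 : ℂ), p w := by
  rw [eventually_nhdsWithin_iff]
  filter_upwards [Metric.ball_mem_nhds (0 : ℂ) hR] with w hw hw0
  exact h w hw0 (by simpa using hw)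

theorem differentiableOn_of_hasSum {a : ℕ → ℂ} {G : ℂ → ℂ} {R : ℝ}
    (h : ∀ w : ℂ, ‖w‖ < R → HasSum (fun n => a n * w ^ n) (G w)) :
    DifferentiableOn ℂ G (Metric.ball 0 R) := by
  rcases le_or_gt R 0 with hR | hR
  · rw [Metric.ball_eq_empty.2 hR]; exact differentiableOn_empty
  have hp : HasFPowerSeriesOnBall G (FormalMultilinearSeries.ofScalars ℂ a) 0
      (ENNReal.ofReal R) := by
    refine ⟨?_, by simpa using hR, fun {y} hy => ?_⟩
    · refine ENNReal.le_of_forall_nnreal_lt fun r hr => ?_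
      refine FormalMultilinearSeries.le_radius_of_summable_norm _ ?_
      have hr' : ‖((r : ℝ) : ℂ)‖ < R := by
        rw [Complex.norm_real, Real.norm_of_nonneg r.coe_nonneg]
        exact (ENNReal.lt_ofReal_iff_toReal_lt (by simp)).1 hr
      refine (h _ hr').summable.norm.congr fun n => ?_
      rw [norm_mul, norm_pow, Complex.norm_real, Real.norm_of_nonneg r.coe_nonneg,
        FormalMultilinearSeries.ofScalars_norm]
    · have hy' : ‖y‖ < R := by
        rw [Metric.mem_eball, edist_zero_right, ← ofReal_norm] at hy
        exact (ENNReal.ofReal_lt_ofReal_iff hR).1 hy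
      rw [zero_add]
      refine (h y hy').congr_fun fun n => ?_
      rw [FormalMultilinearSeries.apply_eq_pow_smul_coeff,
        FormalMultilinearSeries.coeff_ofScalars, smul_eq_mul, mul_comm]
  have := hp.differentiableOn
  rwa [Metric.eball_ofReal] at this

theorem exists_hasSum_of_differentiableOn {G : ℂ → ℂ} {ρ : ℝ} (hρ : 0 < ρ)
    (h : DifferentiableOn ℂ G (Metric.closedBall 0 ρ)) :
    ∃ a : ℕ → ℂ, ∀ w : ℂ, ‖w‖ < ρ → HasSum (fun n => a n * w ^ n) (G w) := by
  lift ρ to NNReal using hρ.le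
  have hp := h.hasFPowerSeriesOnBall (by exact_mod_cast hρ)
  refine ⟨fun n => (cauchyPowerSeries G 0 ρ).coeff n, fun w hw => ?_⟩
  have hw' : w ∈ Metric.eball (0 : ℂ) ρ := by
    rw [Metric.mem_eball, edist_zero_right]
    exact_mod_cast (by exact_mod_cast hw : ‖w‖₊ < ρ)
  have := hp.hasSum hw'
  rw [zero_add] at this
  refine this.congr_fun fun n => ?_
  rw [FormalMultilinearSeries.apply_eq_pow_smul_coeff, smul_eq_mul, mul_comm]

/-! ### The `q`-Bernoulli polynomials -/

theorem eta_ne_zero {q : ℝ} (hq : 0 < q) : eta q ≠ 0 := by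
  unfold eta rp
  have h1 := Real.rpow_pos_of_pos hq (1 / 4)
  have h2 := Real.rpow_pos_of_pos hq (-1 / 4)
  exact_mod_cast (by positivity : (q ^ (1 / 4 : ℝ) + q ^ (-1 / 4 : ℝ)) / 2 ≠ 0)

open PowerSeries in
/-- The generating functions of both families of `q`-Bernoulli polynomials converge for `‖w‖ < ρ`,
and comparing odd parts in `w` expresses `eCoef` through their members of odd index. In terms of
`σ : w ↦ -w` and the inverse `I` of the even function `(ℰ_q(η; w) - ℰ_q(η; -w)) / w`, the generating
functions are `B = ℰ_q(x; w) I` and `β = ℰ_q(η; -w) B`, and the identity is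
`(B - σB) ℰ_q(η; w) - (β - σβ) = w ℰ_q(x; w)`. -/
theorem exists_bernoulli_expansion {q : ℝ} (hq : 0 < q) (hq1 : q < 1) {w₁ : ℝ}
    (hw₁ : IsLeast {w : ℝ | 0 < w ∧ sinEta q w = 0} w₁) {ρ : ℝ} (hρ0 : 0 < ρ)
    (hρ : ρ < min 1 w₁) (x : ℂ) :
    (∀ w : ℂ, ‖w‖ < ρ → Summable fun n => bernB q n x * w ^ n) ∧
    (∀ w : ℂ, ‖w‖ < ρ → Summable fun n => bernBeta q n x * w ^ n) ∧
    ∀ n, eCoef q n x = ∑ ij ∈ Finset.HasAntidiagonal.antidiagonal n,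
        ((1 + (-1) ^ ij.1) * bernB q (ij.1 + 1) x) * eCoef q ij.2 (eta q) -
      (1 + (-1) ^ n) * bernBeta q (n + 1) x := by
  have hρ1 : ρ < 1 := hρ.trans_le (min_le_left _ _)
  have hρw : ρ < w₁ := hρ.trans_le (min_le_right _ _)
  set Ex : PowerSeries ℂ := PowerSeries.mk fun n => eCoef q n x with hEx
  set Eη : PowerSeries ℂ := PowerSeries.mk fun n => eCoef q n (eta q) with hEη
  set D : PowerSeries ℂ := PowerSeries.mk fun n => (1 + (-1) ^ n) * eCoef q (n + 1) (eta q) with hD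
  set σ := rescale (-1 : ℂ) with hσ
  have hσX : ∀ F : PowerSeries ℂ,
      X * (PowerSeries.mk fun n => (1 + (-1) ^ n) * coeff (n + 1) F) = F - σ F := by
    intro F
    ext n
    rcases n with _ | n
    · rw [coeff_zero_X_mul, map_sub, hσ, coeff_rescale, pow_zero, one_mul, sub_self]
    · rw [coeff_succ_X_mul, coeff_mk, map_sub, hσ, coeff_rescale]; ring
  have hXD : X * D = Eη - σ Eη := by
    rw [← hσX]; simp [hD, hEη]
  have hσD : σ D = D := by
    ext n
    rw [hσ, coeff_rescale, hD, coeff_mk, ← mul_assoc, mul_add, mul_one, ← mul_pow]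
    norm_num [add_comm]
  have hsE : ∀ y w : ℂ, ‖w‖ < 1 → HasSum
      (fun n => coeff n (PowerSeries.mk fun n => eCoef q n y) * w ^ n) (qExp q y w) := by
    intro y w hw; simpa using hasSum_qExp hq hq1 y hw
  have hsσ : ∀ w : ℂ, ‖w‖ < 1 → HasSum (fun n => coeff n (σ Eη) * w ^ n)
      (qExp q (eta q) (-w)) := by
    intro w hw
    refine (hsE (eta q) (-w) (by rwa [norm_neg])).congr_fun fun n => ?_
    rw [hσ, coeff_rescale, neg_pow w]; ring
  -- the denominator divided by `w`
  have hsD0 : ∀ w : ℂ, ‖w‖ < 1 → Summable fun n => coeff n D * w ^ n := by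
    intro w hw
    obtain ⟨C, hC0, hC⟩ := exists_norm_eCoef_le hq hq1 (eta q)
    refine Summable.of_norm_bounded ((summable_geometric_of_lt_one (norm_nonneg _) hw).mul_left
      (2 * C)) fun n => ?_
    rw [hD, coeff_mk, norm_mul, norm_mul, norm_pow]
    refine mul_le_mul_of_nonneg_right (mul_le_mul ?_ (hC _) (norm_nonneg _) (by norm_num))
      (by positivity)
    refine (norm_add_le _ _).trans ?_
    simp; norm_num
  set Dl : ℂ → ℂ := fun w => ∑' n, coeff n D * w ^ n with hDl
  have hsD : ∀ w : ℂ, ‖w‖ < 1 → HasSum (fun n => coeff n D * w ^ n) (Dl w) :=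
    fun w hw => (hsD0 w hw).hasSum
  have hsX : ∀ w : ℂ, HasSum (fun n => coeff n (X : PowerSeries ℂ) * w ^ n) w := by
    intro w
    have := hasSum_single (f := fun n => coeff n (X : PowerSeries ℂ) * w ^ n) 1
      (fun n hn => by simp [coeff_X, hn])
    simpa using this
  have hwD : ∀ w : ℂ, ‖w‖ < 1 → qExp q (eta q) w - qExp q (eta q) (-w) = w * Dl w := by
    intro w hw
    have h1 := hasSum_coeff_mul (hsX w) (hsD w hw)
    have h2 := (hsE (eta q) w hw).sub (hsσ w hw)
    rw [hXD] at h1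
    refine h2.unique (h1.congr_fun fun n => ?_)
    rw [map_sub]; ring
  have hDne : ∀ w : ℂ, ‖w‖ ≤ ρ → Dl w ≠ 0 := by
    intro w hw
    rcases eq_or_ne w 0 with rfl | hw0
    · have : Dl 0 = coeff 0 D := by
        simp only [hDl]
        rw [tsum_eq_single 0 fun n hn => by simp [hn]]
        simp
      rw [this, hD, coeff_mk, eCoef_one]
      have h1 : (1 : ℂ) - q ≠ 0 := by simpa using one_sub_pow_ne_zero (norm_q_lt_one hq hq1) 0
      have h2 := eta_ne_zero hq
      have h3 := rp_ne_zero hq (1 / 4)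
      have h4 : (1 : ℂ) + (-1) ^ 0 ≠ 0 := by norm_num
      exact mul_ne_zero h4 (div_ne_zero (mul_ne_zero h3 (mul_ne_zero two_ne_zero h2)) h1)
    · have := qExp_eta_sub_ne_zero hq hq1 hw₁ hw0 (hw.trans_lt hρ1) (hw.trans_lt hρw)
      rw [hwD w (hw.trans_lt hρ1)] at this
      exact right_ne_zero_of_mul this
  obtain ⟨i, hi⟩ := exists_hasSum_of_differentiableOn (G := fun w => (Dl w)⁻¹) hρ0
    (DifferentiableOn.inv ((differentiableOn_of_hasSum (R := 1) (a := fun n => coeff n D)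
      hsD).mono (Metric.closedBall_subset_ball hρ1)) fun w hw => hDne w (by simpa using hw))
  set I : PowerSeries ℂ := PowerSeries.mk i with hI
  have hsI : ∀ w : ℂ, ‖w‖ < ρ → HasSum (fun n => coeff n I * w ^ n) (Dl w)⁻¹ := by
    intro w hw; simpa [hI] using hi w hw
  have hID : I * D = 1 := by
    have h1 : ∀ᶠ w in 𝓝[≠] (0 : ℂ), HasSum (fun n => coeff n (I * D) * w ^ n) ((fun _ => 1) w) :=
      eventually_punctured_of_norm_lt hρ0 fun w _ hw => by
        have := hasSum_coeff_mul (hsI w hw) (hsD w (hw.trans hρ1))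
        rwa [inv_mul_cancel₀ (hDne w hw.le)] at this
    have h2 : ∀ᶠ w in 𝓝[≠] (0 : ℂ),
        HasSum (fun n => coeff n (1 : PowerSeries ℂ) * w ^ n) ((fun _ => 1) w) :=
      Eventually.of_forall fun w => by
        have := hasSum_single (f := fun n => coeff n (1 : PowerSeries ℂ) * w ^ n) 0
          (fun n hn => by simp [coeff_one, hn])
        simpa using this
    have h3 := (genCoeff_eq h1).symm.trans (genCoeff_eq h2)
    ext n
    exact congrFun h3 n
  have hσI : σ I = I := by
    have h1 : σ I * D = 1 := by
      have := congrArg σ hID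
      rwa [map_mul, hσD, map_one] at this
    linear_combination I * h1 - σ I * hID
  have hσσ : ∀ F, σ (σ F) = F := fun F => by
    ext n; rw [hσ, coeff_rescale, coeff_rescale, ← mul_assoc, ← mul_pow]; norm_num
  have hsB : ∀ w : ℂ, ‖w‖ < ρ → HasSum (fun n => coeff n (Ex * I) * w ^ n)
      (qExp q x w * (Dl w)⁻¹) := fun w hw =>
    hasSum_coeff_mul (hsE x w (hw.trans hρ1)) (hsI w hw)
  have hsβ : ∀ w : ℂ, ‖w‖ < ρ → HasSum (fun n => coeff n (σ Eη * (Ex * I)) * w ^ n)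
      (qExp q (eta q) (-w) * (qExp q x w * (Dl w)⁻¹)) := fun w hw =>
    hasSum_coeff_mul (hsσ w (hw.trans hρ1)) (hsB w hw)
  have hB : ∀ n, bernB q n x = coeff n (Ex * I) := by
    intro n
    refine congrFun (f := genCoeff fun w => w * qExp q x w /
      (qExp q (eta q) w - qExp q (eta q) (-w))) (g := fun n => coeff n (Ex * I))
      (genCoeff_eq (eventually_punctured_of_norm_lt hρ0 fun w hw0 hw => ?_)) n
    have h1 := hDne w hw.le
    have h2 := hsB w hw
    rw [hwD w (hw.trans hρ1)]
    convert h2 using 1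
    field_simp
  have hβ : ∀ n, bernBeta q n x = coeff n (σ Eη * (Ex * I)) := by
    intro n
    refine congrFun (f := genCoeff fun w => w * qExp q (eta q) (-w) * qExp q x w /
      (qExp q (eta q) w - qExp q (eta q) (-w))) (g := fun n => coeff n (σ Eη * (Ex * I)))
      (genCoeff_eq (eventually_punctured_of_norm_lt hρ0 fun w hw0 hw => ?_)) n
    have h1 := hDne w hw.le
    have h2 := hsβ w hw
    rw [hwD w (hw.trans hρ1)]
    convert h2 using 1
    field_simp
  refine ⟨fun w hw => ?_, fun w hw => ?_, fun n => ?_⟩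
  · simpa only [hB] using (hsB w hw).summable
  · simpa only [hβ] using (hsβ w hw).summable
  · have h1 := hσX (Ex * I)
    have h2 := hσX (σ Eη * (Ex * I))
    have key : Ex = (PowerSeries.mk fun n => (1 + (-1) ^ n) * coeff (n + 1) (Ex * I)) * Eη -
        PowerSeries.mk fun n => (1 + (-1) ^ n) * coeff (n + 1) (σ Eη * (Ex * I)) := by
      apply mul_left_cancel₀ (X_ne_zero (R := ℂ))
      rw [mul_sub, ← mul_assoc X, h1, h2]
      simp only [map_mul, hσσ, hσI]
      linear_combination -X * Ex * hID + I * Ex * hXD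
    have h3 := congrArg (coeff n) key
    rw [map_sub, coeff_mul, coeff_mk] at h3
    simp only [hB, hβ]
    simpa [hEx, hEη] using h3

/-! ### The Lidstone series -/

/-- The lattice through `η` avoids `x = ±1`: its points have `z² = q^{j + 1/2}`. -/
theorem latZ_eta_sq_ne_one {q : ℝ} (hq : 0 < q) (hq1 : q < 1) (j : ℤ) :
    latZ q (rp q (1 / 4)) j ^ 2 ≠ 1 := by
  have hr : rp q (1 / 4) ^ 2 = rp q (1 / 2) := by rw [sq, ← rp_add hq]; norm_num
  have hP := rp_ne_zero hq (1 / 2)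
  intro h
  have h1 : (q : ℂ) ^ (2 * j + 1) = 1 := by
    rw [← rp_half_sq hq, ← zpow_natCast, ← zpow_mul,
      show ((2 : ℕ) : ℤ) * (2 * j + 1) = (1 + j * 2) + (1 + j * 2) by push_cast; ring,
      zpow_add₀ hP, zpow_add₀ hP, zpow_one, zpow_mul]
    unfold latZ at h
    rw [mul_pow, hr] at h
    norm_cast at h ⊢
    rw [h, one_mul]
  have h2 : q ^ (2 * j + 1) = 1 := by exact_mod_cast h1
  have h3 := (zpow_eq_one_iff_right₀ hq.le hq1.ne).1 h2
  omega

theorem jouk_latZ_eta_zero {q : ℝ} (hq : 0 < q) : jouk (latZ q (rp q (1 / 4)) 0) = eta q := by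
  simp [latZ, eta_eq_jouk hq]

/-- Applying `γ^{-k} 𝒟_q^k` termwise at `η` shifts the expansion in the polynomials `eCoef`. -/
theorem hasSum_awD_iterate_eta {q : ℝ} (hq : 0 < q) (hq1 : q < 1) {f : ℂ → ℂ} {g : ℕ → ℂ}
    (h : ∀ x, HasSum (fun n => g n * eCoef q n x) (f x)) (k : ℕ) :
    HasSum (fun m => g (m + k) * eCoef q m (eta q))
      ((gam q ^ k)⁻¹ * (awD q)^[k] f (eta q)) := by
  have h0 := rp_ne_zero hq (1 / 4)
  have hne := latZ_eta_sq_ne_one hq hq1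
  have hg := pow_ne_zero k (gam_ne_zero hq hq1)
  set z₀ := rp q (1 / 4)
  have h1 := hasSum_latD_pow (latStep q z₀) k
    (fun n => g n • fun j => eCoef q n (jouk (latZ q z₀ j)))
    (fun j => f (jouk (latZ q z₀ j))) (fun j => h _) 0
  rw [← awD_iterate_latZ hq h0 hne, jouk_latZ_eta_zero hq] at h1
  have h2 := (hasSum_nat_add_iff' k).2 h1
  rw [Finset.sum_eq_zero, sub_zero] at h2
  · refine (h2.mul_left (gam q ^ k)⁻¹).congr_fun fun m => ?_
    rw [map_smul, latD_pow_eCoef_add hq hq1 h0 hne, Pi.smul_apply, Pi.smul_apply,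
      jouk_latZ_eta_zero hq, smul_eq_mul, smul_eq_mul]
    field_simp
  · intro n hn
    rw [map_smul, latD_pow_eCoef_of_lt hq hq1 h0 hne (Finset.mem_range.1 hn), smul_zero]
    rfl

theorem exists_norm_le_geometric_of_limsup {a : ℕ → ℂ} {τ r : ℝ} (hr : 0 < r) (hτr : τ < r)
    (h : limsup (fun n : ℕ => ‖a n‖ₑ ^ (1 / (n : ℝ))) atTop = ENNReal.ofReal τ) :
    ∃ C : ℝ, 0 < C ∧ ∀ n, ‖a n‖ ≤ C * r ^ n := by
  have h1 : ∀ᶠ n : ℕ in atTop, ‖a n‖ₑ ^ (1 / (n : ℝ)) < ENNReal.ofReal r :=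
    eventually_lt_of_limsup_lt (h ▸ (ENNReal.ofReal_lt_ofReal_iff hr).2 hτr)
  obtain ⟨n0, hn0⟩ := eventually_atTop.1 (h1.and (eventually_gt_atTop 0))
  have h2 : ∀ n ≥ n0, ‖a n‖ ≤ r ^ n := by
    intro n hn
    obtain ⟨h3, h4⟩ := hn0 n hn
    have hn' : (n : ℝ) ≠ 0 := by exact_mod_cast h4.ne'
    have h5 := ENNReal.rpow_le_rpow h3.le (Nat.cast_nonneg (α := ℝ) n)
    rw [← ENNReal.rpow_mul, one_div, inv_mul_cancel₀ hn', ENNReal.rpow_one, ENNReal.rpow_natCast,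
      ← ENNReal.ofReal_pow hr.le, ← ofReal_norm, ENNReal.ofReal_le_ofReal_iff (by positivity)] at h5
    exact h5
  refine ⟨1 + ∑ i ∈ Finset.range n0, ‖a i‖ / r ^ i, by positivity, fun n => ?_⟩
  by_cases hn : n < n0
  · have := Finset.single_le_sum (f := fun i => ‖a i‖ / r ^ i) (fun i _ => by positivity)
      (Finset.mem_range.2 hn)
    rw [← div_le_iff₀ (by positivity)]
    linarith
  · refine (h2 n (not_lt.1 hn)).trans (le_mul_of_one_le_left (by positivity) ?_)
    have : 0 ≤ ∑ i ∈ Finset.range n0, ‖a i‖ / r ^ i :=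
      Finset.sum_nonneg fun i _ => by positivity
    linarith

/-- Rearrangement of an absolutely convergent double series along the diagonals. -/
theorem diagonal_rearrangement {g b e t y G : ℕ → ℂ} {s : ℂ}
    (hF : Summable fun p : ℕ × ℕ => g (p.1 + p.2) * (b p.1 * e p.2))
    (hG : ∀ i, HasSum (fun j => g (j + i) * e j) (G i))
    (ht : Summable fun n => g n * t n)
    (hy : ∀ n, y n = ∑ ij ∈ Finset.HasAntidiagonal.antidiagonal n, b ij.1 * e ij.2 - t n)
    (hs : HasSum (fun n => g n * y n) s) :
    Summable (fun i => G i * b i) ∧ s = ∑' i, G i * b i - ∑' n, g n * t n := by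
  have hrow : ∀ i, HasSum (fun j => g (i + j) * (b i * e j)) (G i * b i) := fun i => by
    refine ((hG i).mul_right (b i)).congr_fun fun j => ?_
    rw [add_comm i]; ring
  have h1 := hF.hasSum.prod_fiberwise hrow
  have h2 := ((Finset.HasAntidiagonal.sigmaAntidiagonalEquivProd (A := ℕ)).hasSum_iff.2
    hF.hasSum).sigma (fun n => hasSum_fintype _)
  have h3 : HasSum (fun n => g n * (y n + t n))
      (∑' p : ℕ × ℕ, g (p.1 + p.2) * (b p.1 * e p.2)) := by
    refine h2.congr_fun fun n => ?_
    rw [hy, sub_add_cancel, Finset.mul_sum, Finset.univ_eq_attach, ← Finset.sum_attach]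
    refine Finset.sum_congr rfl fun ij _ => ?_
    have := Finset.HasAntidiagonal.mem_antidiagonal.1 ij.2
    simp [Finset.HasAntidiagonal.sigmaAntidiagonalEquivProd, this]
  refine ⟨h1.summable, ?_⟩
  rw [h1.tsum_eq]
  have h4 := h3.sub ht.hasSum
  exact hs.unique (h4.congr_fun fun n => by ring)

/-- The factor `1 + (-1)ⁿ` selects twice the terms of even index. -/
theorem tsum_one_add_neg_one_pow_mul {u : ℕ → ℂ} (h : Summable fun n => (1 + (-1) ^ n) * u n) :
    (Summable fun k => u (2 * k)) ∧ ∑' n, (1 + (-1) ^ n) * u n = 2 * ∑' k, u (2 * k) := by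
  have h1 := h.comp_injective (mul_right_injective₀ (two_ne_zero (α := ℕ)))
  have h2 : ∀ k, (1 + (-1) ^ (2 * k)) * u (2 * k) = 2 * u (2 * k) := fun k => by
    rw [pow_mul]; norm_num
  have h3 : ∀ k, (1 + (-1) ^ (2 * k + 1)) * u (2 * k + 1) = 0 := fun k => by
    rw [pow_succ, pow_mul]; norm_num
  have h4 : Summable fun k => 2 * u (2 * k) := h1.congr fun k => h2 k
  refine ⟨(summable_mul_left_iff two_ne_zero).1 h4, ?_⟩
  have h5 : HasSum (fun k => (1 + (-1) ^ (2 * k)) * u (2 * k)) (∑' k, 2 * u (2 * k)) := by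
    simp only [h2]; exact h4.hasSum
  have h6 : HasSum (fun k => (1 + (-1) ^ (2 * k + 1)) * u (2 * k + 1)) 0 := by
    simp only [h3]; exact hasSum_zero
  have h7 := HasSum.even_add_odd (f := fun n => (1 + (-1) ^ n) * u n) h5 h6
  rw [h7.tsum_eq, add_zero, tsum_mul_left]

theorem exists_norm_mul_pow_le_of_summable {b : ℕ → ℂ} {r : ℝ} (hr : 0 < r)
    (h : Summable fun n => b n * (r : ℂ) ^ n) : ∃ C : ℝ, 0 < C ∧ ∀ n, ‖b n‖ ≤ C * (r⁻¹) ^ n := by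
  obtain ⟨C, hC⟩ := (Metric.isBounded_range_of_tendsto _ h.tendsto_atTop_zero).exists_norm_le
  refine ⟨max C 1, by positivity, fun n => ?_⟩
  have := hC _ ⟨n, rfl⟩
  rw [norm_mul, norm_pow, Complex.norm_real, Real.norm_of_nonneg hr.le,
    ← le_div_iff₀ (by positivity)] at this
  rw [inv_pow, ← div_eq_mul_inv]
  exact this.trans (div_le_div_of_nonneg_right (le_max_left _ _) (by positivity))

theorem norm_one_add_neg_one_pow_le (n : ℕ) : ‖(1 : ℂ) + (-1) ^ n‖ ≤ 2 := by
  refine (norm_add_le _ _).trans ?_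
  simp; norm_num

/-- The expansion in odd-indexed `q`-Bernoulli polynomials holds for every function with a
`q`-Taylor expansion at `0` whose normalized coefficients decay fast enough. -/
theorem lidstone_expansion {q : ℝ} (hq : 0 < q) (hq1 : q < 1) {f : ℂ → ℂ}
    (h : ∀ x, HasSum (fun n => awCoef q f n * eCoef q n x) (f x)) {w₁ τ : ℝ}
    (hw₁ : IsLeast {w : ℝ | 0 < w ∧ sinEta q w = 0} w₁)
    (hlim : limsup (fun n : ℕ => ‖awCoef q f n‖ₑ ^ (1 / (n : ℝ))) atTop = ENNReal.ofReal τ)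
    (hτ0 : 0 < τ) (hτ : τ < min 1 w₁) (x : ℂ) :
    Summable (fun k : ℕ => (gam q ^ (2 * k))⁻¹ * (awD q)^[2 * k] f (eta q) *
      bernB q (2 * k + 1) x) ∧
    Summable (fun k : ℕ => (gam q ^ (2 * k))⁻¹ * (awD q)^[2 * k] f 0 *
      bernBeta q (2 * k + 1) x) ∧
    f x = 2 * ∑' k : ℕ, (gam q ^ (2 * k))⁻¹ * (awD q)^[2 * k] f (eta q) * bernB q (2 * k + 1) x
      - 2 * ∑' k : ℕ, (gam q ^ (2 * k))⁻¹ * (awD q)^[2 * k] f 0 * bernBeta q (2 * k + 1) x := by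
  -- radii `τ < r₁ < r₂ < ρ < min 1 w₁`
  obtain ⟨ρ, hτρ, hρ⟩ := exists_between hτ
  obtain ⟨r₂, hτ2, h2ρ⟩ := exists_between hτρ
  obtain ⟨r₁, hτ1, h12⟩ := exists_between hτ2
  have hr1 : 0 < r₁ := hτ0.trans hτ1
  have hr2 : 0 < r₂ := hr1.trans h12
  have hr11 : r₁ < 1 := h12.trans (h2ρ.trans (hρ.trans_le (min_le_left _ _)))
  obtain ⟨hBs, hβs, hrec⟩ := exists_bernoulli_expansion hq hq1 hw₁ (hr2.trans h2ρ) hρ x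
  have hn2 : ‖(r₂ : ℂ)‖ < ρ := by rwa [Complex.norm_real, Real.norm_of_nonneg hr2.le]
  obtain ⟨CB, hCB0, hCB⟩ := exists_norm_mul_pow_le_of_summable hr2 (hBs _ hn2)
  obtain ⟨Cβ, hCβ0, hCβ⟩ := exists_norm_mul_pow_le_of_summable hr2 (hβs _ hn2)
  obtain ⟨Cg, hCg0, hCg⟩ := exists_norm_le_geometric_of_limsup hr1 hτ1 hlim
  obtain ⟨Ce, hCe0, hCe⟩ := exists_norm_eCoef_le hq hq1 (eta q)
  have hratio : r₁ * r₂⁻¹ < 1 := by rwa [← div_eq_mul_inv, div_lt_one hr2]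
  have hF : Summable fun p : ℕ × ℕ => awCoef q f (p.1 + p.2) *
      (((1 + (-1) ^ p.1) * bernB q (p.1 + 1) x) * eCoef q p.2 (eta q)) := by
    have hgeo := ((summable_geometric_of_lt_one (by positivity) hratio).mul_of_nonneg
      (summable_geometric_of_lt_one hr1.le hr11) (fun n => by positivity)
      (fun n => by positivity)).mul_left (Cg * (2 * (CB * r₂⁻¹)) * Ce)
    refine Summable.of_norm_bounded hgeo fun p => ?_
    rw [norm_mul, norm_mul, norm_mul]
    calc _ ≤ (Cg * r₁ ^ (p.1 + p.2)) * ((2 * (CB * r₂⁻¹ ^ (p.1 + 1))) * Ce) := by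
          gcongr
          · exact hCg _
          · exact norm_one_add_neg_one_pow_le _
          · exact hCB _
          · exact hCe _
      _ = _ := by rw [mul_pow]; ring
  have ht : Summable fun n => awCoef q f n * ((1 + (-1) ^ n) * bernBeta q (n + 1) x) := by
    have hgeo := (summable_geometric_of_lt_one (by positivity) hratio).mul_left
      (Cg * (2 * (Cβ * r₂⁻¹)))
    refine Summable.of_norm_bounded hgeo fun n => ?_
    rw [norm_mul, norm_mul]
    calc _ ≤ (Cg * r₁ ^ n) * (2 * (Cβ * r₂⁻¹ ^ (n + 1))) := by
          gcongr
          · exact hCg _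
          · exact norm_one_add_neg_one_pow_le _
          · exact hCβ _
      _ = _ := by rw [mul_pow]; ring
  obtain ⟨hs1, hs2⟩ := diagonal_rearrangement (g := awCoef q f)
    (b := fun i => (1 + (-1) ^ i) * bernB q (i + 1) x) (e := fun j => eCoef q j (eta q))
    (t := fun n => (1 + (-1) ^ n) * bernBeta q (n + 1) x) (y := fun n => eCoef q n x)
    (G := fun n => (gam q ^ n)⁻¹ * (awD q)^[n] f (eta q))
    hF (hasSum_awD_iterate_eta hq hq1 h) ht hrec (h x)
  have e1 : ∀ n, (gam q ^ n)⁻¹ * (awD q)^[n] f (eta q) * ((1 + (-1) ^ n) * bernB q (n + 1) x) =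
      (1 + (-1) ^ n) * ((gam q ^ n)⁻¹ * (awD q)^[n] f (eta q) * bernB q (n + 1) x) :=
    fun n => by ring
  have e2 : ∀ n, awCoef q f n * ((1 + (-1) ^ n) * bernBeta q (n + 1) x) =
      (1 + (-1) ^ n) * ((gam q ^ n)⁻¹ * (awD q)^[n] f 0 * bernBeta q (n + 1) x) :=
    fun n => by rw [awCoef]; ring
  simp only [e1] at hs1 hs2
  simp only [e2] at ht hs2
  obtain ⟨hB1, hB2⟩ := tsum_one_add_neg_one_pow_mul hs1
  obtain ⟨hβ1, hβ2⟩ := tsum_one_add_neg_one_pow_mul ht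
  exact ⟨hB1, hβ1, by rw [hs2, hB2, hβ2]⟩

end AWLidstone

end

theorem theorem3p4 (q : ℝ) (hq0 : 0 < q) (hq1 : q < 1)
    (f : ℂ → ℂ) (hf : Differentiable ℂ f)
    (hgrowth :
      (∃ k α : ℝ, k < 2 * Real.log q⁻¹ ∧ AWLidstone.QExpGrowth q f k α) ∨
      (∃ α : ℝ, α < 2 * Real.log 2 / Real.log q⁻¹ ∧
        AWLidstone.QExpGrowth q f (2 * Real.log q⁻¹) α)) :
    (∀ x : ℂ, HasSum (fun k : ℕ =>
      AWLidstone.rp q (((k : ℝ) ^ 2 - k) / 4) * (1 - (q : ℂ)) ^ k /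
        (2 ^ k * AWLidstone.qPoch q q k) *
        ((AWLidstone.awD q)^[k] f 0) * AWLidstone.rho q k x) (f x)) ∧
    (∀ w₁ τ : ℝ, IsLeast {w : ℝ | 0 < w ∧ AWLidstone.sinEta q w = 0} w₁ →
      limsup (fun n : ℕ =>
        ‖(AWLidstone.gam q ^ n)⁻¹ * (AWLidstone.awD q)^[n] f 0‖ₑ ^ (1 / (n : ℝ))) atTop =
          ENNReal.ofReal τ →
      0 < τ → τ < min 1 w₁ →
      ∀ x : ℂ,
        Summable (fun k : ℕ => (AWLidstone.gam q ^ (2 * k))⁻¹ *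
          (AWLidstone.awD q)^[2 * k] f (AWLidstone.eta q) *
          AWLidstone.bernB q (2 * k + 1) x) ∧
        Summable (fun k : ℕ => (AWLidstone.gam q ^ (2 * k))⁻¹ *
          (AWLidstone.awD q)^[2 * k] f 0 * AWLidstone.bernBeta q (2 * k + 1) x) ∧
        f x = 2 * ∑' k : ℕ, (AWLidstone.gam q ^ (2 * k))⁻¹ *
            (AWLidstone.awD q)^[2 * k] f (AWLidstone.eta q) *
            AWLidstone.bernB q (2 * k + 1) x
          - 2 * ∑' k : ℕ, (AWLidstone.gam q ^ (2 * k))⁻¹ *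
            (AWLidstone.awD q)^[2 * k] f 0 * AWLidstone.bernBeta q (2 * k + 1) x) := by
  have h := AWLidstone.hasSum_awCoef_mul_eCoef hq0 hq1 hf hgrowth
  refine ⟨fun x => ?_, fun w₁ τ hw₁ hlim hτ0 hτ x =>
    AWLidstone.lidstone_expansion hq0 hq1 h hw₁ hlim hτ0 hτ x⟩
  simp only [AWLidstone.rho_term_eq hq0 hq1]
  exact h x
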